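/- Let $R$ be a commutative ring with identity and let $C$ be a semidualizing $R$-module, i.e. $C$ has a resolution by finitely generated projective $R$-modules, the homothety map $R\to \mathrm{Hom}_R(C,C)$ is an isomorphism, and $\mathrm{Ext}_R^i(C,C)=0$ for all $i\ge 1$. A module is called $C$-projective (resp. $C$-flat) if it is isomorphic to $C\otimes_R P$ with $P$ projective (resp. $C\otimes_R F$ with $F$ flat). Let $\mathrm{Ch}(R)$ be the category of ($\mathbb{Z}$-indexed, unbounded) complexes of $R$-modules. A complex is called projective (resp. $C$-projective, $C$-flat) if it is exact and all its cycle modules are projective (resp. $C$-projective, $C$-flat) modules. A complex $X$ is called $D_C$-projective if there is an exact sequence in $\mathrm{Ch}(R)$ $$\cdots\to P_1\to P_0\xrightarrow{f_0} Q_{-1}\to Q_{-2}\to\cdots$$ with all $P_i$ projective complexes and all $Q_i$ $C$-projective complexes, which stays exact under $\mathrm{Hom}_{\mathrm{Ch}(R)}(-,H)$ for every $C$-flat complex $H$, and such that $X\cong \mathrm{Im} f_0$. The $D_C$-projective dimension $D_C\text{-pd}(X)$ of a complex $X$ is the least integer $n\ge 0$ for which there is an exact sequence $0\to G_n\to\cdots\to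 G_0\to X\to 0$ in $\mathrm{Ch}(R)$ with all $G_i$ $D_C$-projective, and $\infty$ if there is no such $n$; the $\mathcal{F}_C$-dimension $\mathcal{F}_C\text{-pd}(X)$ is defined in the same way with all $G_i$ $C$-flat complexes. $\mathrm{Ext}^m$ of complexes is taken in the abelian category $\mathrm{Ch}(R)$. **Theorem 3.3.** Let $X\in\mathrm{Ch}(R)$ and let $n\ge 0$ be an integer. The following are equivalent: 1. $D_C\text{-pd}(X)\le n$. 2. $D_C\text{-pd}(X)<\infty$ and $\mathrm{Ext}^m(X,H)=0$ for all $m>n$ and all $H\in\mathrm{Ch}(R)$ with $\mathcal{F}_C\text{-pd}(H)<\infty$. 3. $D_C\text{-pd}(X)<\infty$ and $\mathrm{Ext}^m(X,H)=0$ for all $m>n$ and all $C$-flat complexes $H$. 4. For every exact sequence $\cdots\to G_n\to G_{n-1}\to\cdots\to G_0\to X\to 0$ in $\mathrm{Ch}(R)$ with all $G_i$ $D_C$-projective, the kernel $K_n=\mathrm{Ker}(G_{n-1}\to G_{n-2})$ is $D_C$-projective (where $G_{-1}=X$ and $G_{-2}=0$, so that $K_0=X$). 5. For every integer $t$ with $0\le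 t\le n$ there is an exact sequence $$0\to Q_n\to\cdots\to Q_{t+1}\to G_t\to P_{t-1}\to\cdots\to P_0\to X\to 0$$ in $\mathrm{Ch}(R)$ with $G_t$ $D_C$-projective, $Q_i$ a $C$-projective complex for all $i>t$, and $P_i$ a projective complex for all $i<t$. -/

import Mathlib

open CategoryTheory

universe u

namespace DCProj

section Abelian

variable {A : Type*} [Category A] [Abelian A]

/-- A (possibly infinite) exact sequence `⋯ ⟶ G 2 ⟶ G 1 ⟶ G 0 ⟶ X ⟶ 0` in an abelian category:
the terms `G i` with their maps form the chain complex `G`, and `ε` is the last map. -/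
structure ExactResolution (X : A) where
  G : ChainComplex A ℕ
  ε : G.X 0 ⟶ X
  w : G.d 1 0 ≫ ε = 0
  epi_ε : Epi ε
  exact_zero : (ShortComplex.mk (G.d 1 0) ε w).Exact
  exact_succ : ∀ i : ℕ, G.ExactAt (i + 1)

/-- The `n`-th kernel `K_n = Ker (G_{n-1} ⟶ G_{n-2})` of an exact sequence
`⋯ ⟶ G 1 ⟶ G 0 ⟶ X ⟶ 0`, where `G_{-1} = X` and `G_{-2} = 0`; so `K_0 = X`. -/
noncomputable def ExactResolution.kernelObj {X : A} (E : ExactResolution X) : ℕ → A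
  | 0 => X
  | 1 => Limits.kernel E.ε
  | n + 2 => Limits.kernel (E.G.d (n + 1) n)

/-- There is an exact sequence `0 ⟶ G n ⟶ ⋯ ⟶ G 0 ⟶ X ⟶ 0` with all `G i` in the class `P`. -/
def HasResolutionOfLength (P : ObjectProperty A) (X : A) (n : ℕ) : Prop :=
  ∃ E : ExactResolution X, (∀ i ≤ n, P (E.G.X i)) ∧ ∀ i > n, Limits.IsZero (E.G.X i)

/-- The dimension of `X` relative to the class `P`: the least `n` such that there is an exact
sequence `0 ⟶ G n ⟶ ⋯ ⟶ G 0 ⟶ X ⟶ 0` with all `G i` in `P`, and `∞` if there is none. -/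
noncomputable def resDim (P : ObjectProperty A) (X : A) : ℕ∞ :=
  ⨅ (n : ℕ) (_ : HasResolutionOfLength P X n), (n : ℕ∞)

/-- The sequence `Hom(E, H)` of abelian groups is exact for every `H` in the class `B`. -/
def IsHomExact (E : ChainComplex A ℤ) (B : ObjectProperty A) : Prop :=
  ∀ H : A, B H → ∀ (i : ℤ) (g : E.X i ⟶ H), E.d (i + 1) i ≫ g = 0 →
    ∃ h : E.X (i - 1) ⟶ H, E.d i (i - 1) ≫ h = g

end Abelian

variable {R : Type u} [CommRing R]

/-- `C` is a semidualizing `R`-module. -/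
structure IsSemidualizing (C : ModuleCat.{u} R) : Prop where
  /-- `C` has a resolution by finitely generated projective modules. -/
  resolution : ∃ P : ProjectiveResolution C, ∀ n : ℕ, Module.Finite R (P.complex.X n)
  /-- The homothety map `R ⟶ Hom_R(C, C)` is an isomorphism. -/
  homothety : Function.Bijective (LinearMap.lsmul R C)
  ext_eq_zero : ∀ i : ℕ, 1 ≤ i → Subsingleton (Abelian.Ext.{u} C C i)

/-- The class of projective `R`-modules. -/
def projMod (R : Type u) [CommRing R] : ObjectProperty (ModuleCat.{u} R) :=
  fun M => Module.Projective R M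

/-- The class of `C`-projective modules, i.e. those isomorphic to `C ⊗ P` with `P` projective. -/
def cProjMod (C : ModuleCat.{u} R) : ObjectProperty (ModuleCat.{u} R) :=
  fun M => ∃ P : ModuleCat.{u} R, Module.Projective R P ∧ Nonempty (M ≃ₗ[R] TensorProduct R C P)

/-- The class of `C`-flat modules, i.e. those isomorphic to `C ⊗ F` with `F` flat. -/
def cFlatMod (C : ModuleCat.{u} R) : ObjectProperty (ModuleCat.{u} R) :=
  fun M => ∃ F : ModuleCat.{u} R, Module.Flat R F ∧ Nonempty (M ≃ₗ[R] TensorProduct R C F)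

/-- The category `Ch(R)` of unbounded complexes of `R`-modules, with differentials `X i ⟶ X (i-1)`. -/
abbrev Ch (R : Type u) [CommRing R] : Type (u + 1) := ChainComplex (ModuleCat.{u} R) ℤ

/-- The class of exact complexes all of whose cycle modules lie in the class `P` of modules. -/
def tilde (P : ObjectProperty (ModuleCat.{u} R)) : ObjectProperty (Ch R) :=
  fun X => X.Acyclic ∧ ∀ i : ℤ, P (X.cycles i)

/-- The class of projective complexes. -/
def projCx (R : Type u) [CommRing R] : ObjectProperty (Ch R) := tilde (projMod R)

/-- The class of `C`-projective complexes. -/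
def cProjCx (C : ModuleCat.{u} R) : ObjectProperty (Ch R) := tilde (cProjMod C)

/-- The class of `C`-flat complexes. -/
def cFlatCx (C : ModuleCat.{u} R) : ObjectProperty (Ch R) := tilde (cFlatMod C)

/-- The class of `D_C`-projective complexes: `X` is isomorphic to the image of `E 0 ⟶ E (-1)` for
an exact sequence of complexes `E` that stays exact under `Hom(-, H)` for all `C`-flat complexes
`H`, with projective complexes in degrees `≥ 0` and `C`-projective complexes in degrees `< 0`. -/
def dcProjCx (C : ModuleCat.{u} R) : ObjectProperty (Ch R) :=
  fun X => ∃ E : ChainComplex (Ch R) ℤ,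
    E.Acyclic ∧ IsHomExact E (cFlatCx C) ∧
    (∀ i : ℤ, 0 ≤ i → projCx R (E.X i)) ∧
    (∀ i : ℤ, i < 0 → cProjCx C (E.X i)) ∧
    Nonempty (X ≅ Limits.image (E.d 0 (-1)))

/-- The `D_C`-projective dimension of a complex. -/
noncomputable def dcPd (C : ModuleCat.{u} R) (X : Ch R) : ℕ∞ := resDim (dcProjCx C) X

/-- The `F_C`-dimension of a complex, defined by resolutions by `C`-flat complexes. -/
noncomputable def fcPd (C : ModuleCat.{u} R) (X : Ch R) : ℕ∞ := resDim (cFlatCx C) X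

end DCProj

/-!
Let `Q` and `B` be the classes of `C`-projective and of `C`-flat complexes. Since projective and
`C`-projective complexes are `Ext`-orthogonal to `B`, a complex `X` is `D_C`-projective as soon as
`Ext^m(X, B) = 0` for `m ≥ 1` and `X` embeds into some object of `Q` with cokernel of the same kind,
and so on forever. In this form the class is visibly closed under extensions and kernels of
epimorphisms, and the equivalences follow from dimension shifting together with the
Auslander–Buchweitz exchange of a `D_C`-projective resolution for one by objects of `Q`. What this
needs from `C` is that projective complexes are themselves `D_C`-projective. Exact complexes with
projective or `C`-projective cycles are direct sums of disks, so it suffices to coresolve a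
projective module `P` by `C`-projective ones: apply `Hom(-, C) ⊗ P` to a resolution of `C` by
finitely generated projectives and use `R ≅ Hom(C, C)` and `Ext^i(C, C) = 0`.
-/

namespace DCProj

open Limits ZeroObject

universe w w'

section Extension

variable {A : Type*} [Category A] [Abelian A]

/-- `Y` is an extension of `Z` by `X`: there is a short exact sequence `0 ⟶ X ⟶ Y ⟶ Z ⟶ 0`. -/
def IsExtension (X Y Z : A) : Prop :=
  ∃ (f : X ⟶ Y) (g : Y ⟶ Z) (w : f ≫ g = 0), (ShortComplex.mk f g w).ShortExact

/-- `K` is the kernel of an epimorphism from an object of `P` onto `X`; equivalently, `K` embeds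
into an object of `P` with cokernel `X`. -/
def IsSyzygy (P : ObjectProperty A) (K X : A) : Prop :=
  ∃ E : A, P E ∧ IsExtension K E X

lemma exact_of_forall_exists_desc {X Y Z : A} {f : X ⟶ Y} {g : Y ⟶ Z} [Epi g] (w : f ≫ g = 0)
    (H : ∀ {W : A} (k : Y ⟶ W), f ≫ k = 0 → ∃ l : Z ⟶ W, g ≫ l = k) :
    (ShortComplex.mk f g w).Exact :=
  ShortComplex.exact_of_g_is_cokernel _ <| CokernelCofork.IsColimit.ofπ' _ _ fun k hk =>
    ⟨(H k hk).choose, (H k hk).choose_spec⟩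

lemma exact_epi_comp_mono_iff {X Y Z X' Z' : A} (e : X' ⟶ X) (f : X ⟶ Y) (g : Y ⟶ Z) (m : Z ⟶ Z')
    [Epi e] [Mono m] (w : f ≫ g = 0) (w' : (e ≫ f) ≫ g ≫ m = 0) :
    (ShortComplex.mk (e ≫ f) (g ≫ m) w').Exact ↔ (ShortComplex.mk f g w).Exact := by
  have w'' : f ≫ g ≫ m = 0 := by rw [reassoc_of% w, zero_comp]
  let φ : ShortComplex.mk (e ≫ f) (g ≫ m) w' ⟶ ShortComplex.mk f (g ≫ m) w'' :=
    { τ₁ := e, τ₂ := 𝟙 _, τ₃ := 𝟙 _ }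
  let ψ : ShortComplex.mk f g w ⟶ ShortComplex.mk f (g ≫ m) w'' :=
    { τ₁ := 𝟙 _, τ₂ := 𝟙 _, τ₃ := m }
  have : Epi φ.τ₁ := ‹Epi e›
  have : IsIso φ.τ₂ := inferInstanceAs (IsIso (𝟙 Y))
  have : Mono φ.τ₃ := inferInstanceAs (Mono (𝟙 Z'))
  have : Epi ψ.τ₁ := inferInstanceAs (Epi (𝟙 X))
  have : IsIso ψ.τ₂ := inferInstanceAs (IsIso (𝟙 Y))
  have : Mono ψ.τ₃ := ‹Mono m›
  rw [ShortComplex.exact_iff_of_epi_of_isIso_of_mono φ,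
    ← ShortComplex.exact_iff_of_epi_of_isIso_of_mono ψ]

lemma exists_shortExact_of_isPushout {X Y Z X' P : A} {f : X ⟶ Y} {g : Y ⟶ Z} {w : f ≫ g = 0}
    (h : (ShortComplex.mk f g w).ShortExact) {i : X ⟶ X'} {inl : Y ⟶ P} {inr : X' ⟶ P}
    (sq : IsPushout f i inl inr) :
    ∃ (b : P ⟶ Z) (w' : inr ≫ b = 0), (ShortComplex.mk inr b w').ShortExact := by
  have : Mono f := h.mono_f
  have : Epi g := h.epi_g
  have : Mono inr := (MorphismProperty.monomorphisms A).of_isPushout sq.flip ‹Mono f›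
  let b : P ⟶ Z := sq.desc g 0 (by simp [w])
  have : Epi b := epi_of_epi_fac (sq.inl_desc g 0 (by simp [w]))
  refine ⟨b, by simp [b], { exact := exact_of_forall_exists_desc _ fun k hk => ?_ }⟩
  have hk' : f ≫ inl ≫ k = 0 := by rw [sq.w_assoc, hk, comp_zero]
  exact ⟨h.exact.desc _ hk', sq.hom_ext (by simpa [b] using h.exact.g_desc _ hk') (by simp [b, hk])⟩

lemma shortExact_biprod (X Y : A) :
    (ShortComplex.mk (biprod.inl : X ⟶ X ⊞ Y) biprod.snd biprod.inl_snd).ShortExact :=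
  (ShortComplex.Splitting.ofHasBinaryBiproduct X Y).shortExact

namespace IsExtension

variable {X Y Z : A}

lemma op (h : IsExtension X Y Z) : IsExtension (.op Z) (.op Y) (.op X : Aᵒᵖ) := by
  obtain ⟨f, g, w, h⟩ := h
  exact ⟨g.op, f.op, _, h.op⟩

lemma unop {X Y Z : Aᵒᵖ} (h : IsExtension X Y Z) : IsExtension Z.unop Y.unop X.unop := by
  obtain ⟨f, g, w, h⟩ := h
  exact ⟨g.unop, f.unop, _, h.unop⟩

lemma of_iso (h : IsExtension X Y Z) {X' Y' Z' : A} (eX : X ≅ X') (eY : Y ≅ Y') (eZ : Z ≅ Z') :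
    IsExtension X' Y' Z' := by
  obtain ⟨f, g, w, h⟩ := h
  refine ⟨eX.inv ≫ f ≫ eY.hom, eY.inv ≫ g ≫ eZ.hom, by simp [reassoc_of% w],
    ShortComplex.shortExact_of_iso (ShortComplex.isoMk eX eY eZ ?_ ?_) h⟩ <;> simp

lemma of_epi (g : Y ⟶ Z) [Epi g] : IsExtension (kernel g) Y Z :=
  ⟨kernel.ι g, g, kernel.condition g, { exact := ShortComplex.exact_kernel g }⟩

lemma biprod_left (X Z : A) : IsExtension X (X ⊞ Z) Z :=
  ⟨_, _, _, shortExact_biprod X Z⟩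

lemma biprod_right (X Z : A) : IsExtension Z (X ⊞ Z) X :=
  (biprod_left Z X).of_iso (.refl _) (biprod.braiding Z X) (.refl _)

lemma of_isZero_right (X : A) {Z : A} (hZ : IsZero Z) : IsExtension X X Z :=
  (biprod_left X Z).of_iso (.refl _) (isoBiprodZero hZ).symm (.refl _)

lemma of_isZero_left (X : A) {Z : A} (hZ : IsZero Z) : IsExtension Z X X :=
  (biprod_right X Z).of_iso (.refl _) (isoBiprodZero hZ).symm (.refl _)

lemma nonempty_iso_of_isZero_left (h : IsExtension X Y Z) (hX : IsZero X) : Nonempty (Y ≅ Z) := by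
  obtain ⟨f, g, w, h⟩ := h
  have : IsIso g := h.isIso_g_iff.2 hX
  exact ⟨asIso g⟩

lemma exists_pushout_mono (h : IsExtension X Y Z) {X' X'' : A} (h' : IsExtension X X' X'') :
    ∃ P : A, IsExtension X' P Z ∧ IsExtension Y P X'' := by
  obtain ⟨f, g, w, h⟩ := h
  obtain ⟨i, j, w', h'⟩ := h'
  have sq := IsPushout.of_hasPushout f i
  exact ⟨_, ⟨_, exists_shortExact_of_isPushout h sq⟩, _, exists_shortExact_of_isPushout h' sq.flip⟩

lemma exists_pushout_epi (h : IsExtension X Y Z) {K X' : A} (h' : IsExtension K X X') :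
    ∃ P : A, IsExtension X' P Z ∧ IsExtension K Y P := by
  obtain ⟨f, g, w, h⟩ := h
  obtain ⟨k, i, w', h'⟩ := h'
  have sq := IsPushout.of_hasPushout f i
  have : Mono f := h.mono_f
  have : Mono k := h'.mono_f
  have : Epi i := h'.epi_g
  have : Epi (pushout.inl f i) := (MorphismProperty.epimorphisms A).of_isPushout sq ‹Epi i›
  refine ⟨_, ⟨_, exists_shortExact_of_isPushout h sq⟩, k ≫ f, pushout.inl f i,
    by rw [Category.assoc, sq.w, reassoc_of% w', zero_comp],
    { exact := exact_of_forall_exists_desc _ fun m hm => ?_ }⟩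
  rw [Category.assoc] at hm
  exact ⟨sq.desc m (h'.exact.desc _ hm) (h'.exact.g_desc _ hm).symm, sq.inl_desc _ _ _⟩

lemma exists_pullback_epi (h : IsExtension X Y Z) {Z' Z'' : A} (h' : IsExtension Z'' Z' Z) :
    ∃ P : A, IsExtension X P Z' ∧ IsExtension Z'' P Y := by
  obtain ⟨P, h₁, h₂⟩ := h.op.exists_pushout_mono h'.op
  exact ⟨P.unop, h₁.unop, h₂.unop⟩

lemma exists_pullback_mono (h : IsExtension X Y Z) {K Z' : A} (h' : IsExtension Z' Z K) :
    ∃ P : A, IsExtension X P Z' ∧ IsExtension P Y K := by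
  obtain ⟨P, h₁, h₂⟩ := h.op.exists_pushout_epi h'.op
  exact ⟨P.unop, h₁.unop, h₂.unop⟩

lemma kernel_of_exact {f : X ⟶ Y} {g : Y ⟶ Z} {w : f ≫ g = 0} (h : (ShortComplex.mk f g w).Exact) :
    IsExtension (kernel f) X (kernel g) :=
  have : Epi (kernel.lift g f w) := h.epi_kernelLift
  (of_epi (kernel.lift g f w)).of_iso
    ((kernelCompMono _ (kernel.ι g)).symm ≪≫ kernelIsoOfEq (kernel.lift_ι g f w))
    (.refl _) (.refl _)

end IsExtension

end Extension

section Ext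

open Abelian

variable {A : Type*} [Category A] [Abelian A] [HasExt.{w} A]

namespace IsExtension

variable {X Y Z : A}

lemma subsingleton_ext_right (h : IsExtension X Y Z) {H : A} {m : ℕ}
    (hX : Subsingleton (Ext.{w} X H m)) (hY : Subsingleton (Ext.{w} Y H (m + 1))) :
    Subsingleton (Ext.{w} Z H (m + 1)) := by
  obtain ⟨f, g, w, h⟩ := h
  refine subsingleton_of_forall_eq 0 fun x => ?_
  obtain ⟨y, rfl⟩ := Ext.contravariant_sequence_exact₃ h H x (Subsingleton.elim _ _) (add_comm 1 m)
  rw [Subsingleton.elim y 0, Ext.comp_zero]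

lemma subsingleton_ext_mid (h : IsExtension X Y Z) {H : A} {m : ℕ}
    (hX : Subsingleton (Ext.{w} X H m)) (hZ : Subsingleton (Ext.{w} Z H m)) :
    Subsingleton (Ext.{w} Y H m) := by
  obtain ⟨f, g, w, h⟩ := h
  refine subsingleton_of_forall_eq 0 fun x => ?_
  obtain ⟨y, rfl⟩ := Ext.contravariant_sequence_exact₂ h H x (Subsingleton.elim _ _)
  rw [Subsingleton.elim y 0, Ext.comp_zero]

lemma subsingleton_ext_left (h : IsExtension X Y Z) {H : A} {m : ℕ}
    (hY : Subsingleton (Ext.{w} Y H m)) (hZ : Subsingleton (Ext.{w} Z H (m + 1))) :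
    Subsingleton (Ext.{w} X H m) := by
  obtain ⟨f, g, w, h⟩ := h
  refine subsingleton_of_forall_eq 0 fun x => ?_
  obtain ⟨y, rfl⟩ := Ext.contravariant_sequence_exact₁ h H x (add_comm 1 m) (Subsingleton.elim _ _)
  rw [Subsingleton.elim y 0, Ext.comp_zero]

lemma subsingleton_ext_covariant_right (h : IsExtension X Y Z) {U : A} {m : ℕ}
    (hY : Subsingleton (Ext.{w} U Y m)) (hX : Subsingleton (Ext.{w} U X (m + 1))) :
    Subsingleton (Ext.{w} U Z m) := by
  obtain ⟨f, g, w, h⟩ := h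
  refine subsingleton_of_forall_eq 0 fun x => ?_
  obtain ⟨y, rfl⟩ := Ext.covariant_sequence_exact₃ U h x rfl (Subsingleton.elim _ _)
  rw [Subsingleton.elim y 0, Ext.zero_comp]

lemma subsingleton_ext_covariant_mid (h : IsExtension X Y Z) {U : A} {m : ℕ}
    (hX : Subsingleton (Ext.{w} U X m)) (hZ : Subsingleton (Ext.{w} U Z m)) :
    Subsingleton (Ext.{w} U Y m) := by
  obtain ⟨f, g, w, h⟩ := h
  refine subsingleton_of_forall_eq 0 fun x => ?_
  obtain ⟨y, rfl⟩ := Ext.covariant_sequence_exact₂ U h x (Subsingleton.elim _ _)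
  rw [Subsingleton.elim y 0, Ext.zero_comp]

end IsExtension

lemma subsingleton_ext_of_iso {X Y : A} (e : X ≅ Y) {H : A} {m : ℕ}
    (h : Subsingleton (Ext.{w} X H m)) : Subsingleton (Ext.{w} Y H m) := by
  refine subsingleton_of_forall_eq 0 fun x => ?_
  have : x = (Ext.mk₀ e.inv).comp ((Ext.mk₀ e.hom).comp x (zero_add m)) (zero_add m) := by simp
  rw [this, Subsingleton.elim ((Ext.mk₀ e.hom).comp x (zero_add m)) 0, Ext.comp_zero]

lemma exists_comp_eq_of_subsingleton_ext {S : ShortComplex A} (hS : S.ShortExact) {H : A}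
    (hH : Subsingleton (Ext.{w} S.X₃ H 1)) (k : S.X₁ ⟶ H) : ∃ l : S.X₂ ⟶ H, S.f ≫ l = k := by
  obtain ⟨x, hx⟩ := Ext.contravariant_sequence_exact₁ hS H (Ext.mk₀ k) (add_zero 1)
    (Subsingleton.elim _ _)
  obtain ⟨l, rfl⟩ := Ext.addEquiv₀.symm.surjective x
  exact ⟨l, (Ext.mk₀_bijective _ _).1 (by simpa using hx)⟩

lemma subsingleton_ext_one_of_forall_exists_comp_eq {S : ShortComplex A} (hS : S.ShortExact) {H : A}
    (hH : Subsingleton (Ext.{w} S.X₂ H 1)) (hk : ∀ k : S.X₁ ⟶ H, ∃ l : S.X₂ ⟶ H, S.f ≫ l = k) :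
    Subsingleton (Ext.{w} S.X₃ H 1) := by
  refine subsingleton_of_forall_eq 0 fun x => ?_
  obtain ⟨y, rfl⟩ := Ext.contravariant_sequence_exact₃ hS H x (Subsingleton.elim _ _) (add_zero 1)
  obtain ⟨k, rfl⟩ := Ext.addEquiv₀.symm.surjective y
  obtain ⟨l, rfl⟩ := hk k
  have : Ext.addEquiv₀.symm (S.f ≫ l) = (Ext.mk₀ S.f).comp (Ext.mk₀ l) (zero_add 0) := by simp
  rw [this]
  exact hS.extClass_comp_assoc _

namespace IsExtension

variable {X Y Z : A}

lemma nonempty_iso_biprod (h : IsExtension X Y Z) (hZ : Subsingleton (Ext.{w} Z X 1)) :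
    Nonempty (Y ≅ X ⊞ Z) := by
  obtain ⟨f, g, w, h⟩ := h
  obtain ⟨r, hr⟩ := exists_comp_eq_of_subsingleton_ext h hZ (𝟙 X)
  exact ⟨(ShortComplex.Splitting.ofExactOfRetraction _ h.exact r hr h.epi_g).isoBinaryBiproduct⟩

lemma swap (h : IsExtension X Y Z) (hZ : Subsingleton (Ext.{w} Z X 1)) : IsExtension Z Y X := by
  obtain ⟨e⟩ := h.nonempty_iso_biprod hZ
  exact (biprod_right X Z).of_iso (.refl _) e.symm (.refl _)

end IsExtension

/-- The groups `Extⁱ(X, H)` with `i ≥ 1` all vanish. -/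
def NoExt (X H : A) : Prop :=
  ∀ n : ℕ, Subsingleton (Ext.{w} X H (n + 1))

namespace NoExt

variable {X Y Z H : A}

lemma of_projective [Projective X] : NoExt.{w} X H := fun _ =>
  Ext.subsingleton_of_projective _ _ _

lemma of_iso (h : NoExt.{w} X H) (e : X ≅ Y) : NoExt.{w} Y H := fun n =>
  subsingleton_ext_of_iso e (h n)

lemma mid (h : IsExtension X Y Z) (hX : NoExt.{w} X H) (hZ : NoExt.{w} Z H) : NoExt.{w} Y H :=
  fun n => h.subsingleton_ext_mid (hX n) (hZ n)

lemma left (h : IsExtension X Y Z) (hY : NoExt.{w} Y H) (hZ : NoExt.{w} Z H) : NoExt.{w} X H :=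
  fun n => h.subsingleton_ext_left (hY n) (hZ (n + 1))

lemma right {S : ShortComplex A} (hS : S.ShortExact) (h₁ : NoExt.{w} S.X₁ H)
    (h₂ : NoExt.{w} S.X₂ H) (hk : ∀ k : S.X₁ ⟶ H, ∃ l : S.X₂ ⟶ H, S.f ≫ l = k) :
    NoExt.{w} S.X₃ H
  | 0 => subsingleton_ext_one_of_forall_exists_comp_eq hS (h₂ 0) hk
  | n + 1 => IsExtension.subsingleton_ext_right ⟨S.f, S.g, S.zero, hS⟩ (h₁ n) (h₂ (n + 1))

lemma of_iso_right {H' : A} (h : NoExt.{w} X H) (e : H ≅ H') : NoExt.{w} X H' := fun n => by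
  refine subsingleton_of_forall_eq 0 fun x => ?_
  have : x = (x.comp (Ext.mk₀ e.inv) (add_zero _)).comp (Ext.mk₀ e.hom) (add_zero _) := by simp
  rw [this, (h n).elim (x.comp (Ext.mk₀ e.inv) (add_zero _)) 0, Ext.zero_comp]

lemma covariant_mid (h : IsExtension X Y Z) {U : A} (hX : NoExt.{w} U X) (hZ : NoExt.{w} U Z) :
    NoExt.{w} U Y :=
  fun n => h.subsingleton_ext_covariant_mid (hX n) (hZ n)

/-- Dimension shifting: in a class closed under suitable syzygies, extendability of morphisms to
`H` from the syzygies gives the vanishing of all the higher extensions. -/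
lemma of_forall_exists_shortExact {W : ObjectProperty A}
    (hW : ∀ X, W X → ∃ (K P : A) (f : K ⟶ P) (g : P ⟶ X) (w : f ≫ g = 0),
      (ShortComplex.mk f g w).ShortExact ∧ W K ∧ NoExt.{w} P H ∧
        ∀ k : K ⟶ H, ∃ l : P ⟶ H, f ≫ l = k) (hX : W X) : NoExt.{w} X H := by
  intro n
  induction n generalizing X with
  | zero =>
    obtain ⟨K, P, f, g, w, hS, -, hP, hk⟩ := hW X hX
    exact subsingleton_ext_one_of_forall_exists_comp_eq hS (hP 0) hk
  | succ n ih =>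
    obtain ⟨K, P, f, g, w, hS, hK, hP, -⟩ := hW X hX
    exact IsExtension.subsingleton_ext_right ⟨f, g, w, hS⟩ (ih hK) (hP (n + 1))

end NoExt

/-- The class of objects without higher extensions by objects of `ℋ`. -/
def extPerp (ℋ : ObjectProperty A) : ObjectProperty A :=
  fun X => ∀ H, ℋ H → NoExt.{w} X H

end Ext

section Splice

variable {A : Type*} [Category A] [Abelian A]

section

variable {α : Type*} [AddRightCancelSemigroup α] [One α] [DecidableEq α] {K E : α → A}
  {ι : ∀ i, K (i + 1) ⟶ E i} {π : ∀ i, E i ⟶ K i}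

/-- The complex spliced from the sequences `0 ⟶ K (i + 1) ⟶ E i ⟶ K i ⟶ 0`. -/
def splice (w : ∀ i, ι i ≫ π i = 0) : ChainComplex A α :=
  ChainComplex.of E (fun i => π (i + 1) ≫ ι i) fun i => by
    rw [Category.assoc, reassoc_of% w (i + 1), zero_comp, comp_zero]

lemma splice_d (w : ∀ i, ι i ≫ π i = 0) (i : α) : (splice w).d (i + 1) i = π (i + 1) ≫ ι i :=
  ChainComplex.of_d E (fun i => π (i + 1) ≫ ι i) i

lemma exactAt_splice {w : ∀ i, ι i ≫ π i = 0} (h : ∀ i, (ShortComplex.mk _ _ (w i)).ShortExact)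
    (i : α) : (splice w).ExactAt (i + 1) := by
  have : Epi (π (i + 1 + 1)) := (h (i + 1 + 1)).epi_g
  have : Mono (ι i) := (h i).mono_f
  have hex : (ShortComplex.mk ((splice w).d (i + 1 + 1) (i + 1)) ((splice w).d (i + 1) i)
      ((splice w).d_comp_d _ _ _)).Exact := by
    simp only [splice_d]
    exact (exact_epi_comp_mono_iff (π (i + 1 + 1)) _ _ (ι i) (w (i + 1)) _).2 (h (i + 1)).exact
  exact ((splice w).exactAt_iff' _ _ _ (ComplexShape.prev_eq' _ rfl)
    (ComplexShape.next_eq' _ rfl)).2 hex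

end

lemma exists_exactResolution {K E : ℕ → A} (h : ∀ i, IsExtension (K (i + 1)) (E i) (K i)) :
    ∃ F : ExactResolution (K 0), ∀ i, F.G.X i = E i := by
  choose ι π w h using h
  have : Epi (π 1) := (h 1).epi_g
  have hd : (splice w).d 1 0 = π 1 ≫ ι 0 := splice_d w 0
  have hw : (π 1 ≫ ι 0) ≫ π 0 = 0 := by rw [Category.assoc, w, comp_zero]
  have hex : (ShortComplex.mk (π 1 ≫ ι 0) (π 0) hw).Exact := by
    simpa only [Category.comp_id] using
      (exact_epi_comp_mono_iff (π 1) (ι 0) (π 0) (𝟙 _) (w 0) (by simp [w 0])).2 (h 0).exact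
  refine ⟨⟨splice w, π 0, (congrArg (· ≫ π 0) hd).trans hw, (h 0).epi_g, ?_, exactAt_splice h⟩,
    fun _ => rfl⟩
  simp only [hd]
  exact hex

lemma exists_nat_seq {T : Type*} {p : T → Prop} {r : T → T → Prop}
    (h : ∀ a, p a → ∃ b, p b ∧ r a b) {a : T} (ha : p a) :
    ∃ s : ℕ → T, s 0 = a ∧ (∀ n, p (s n)) ∧ ∀ n, r (s n) (s (n + 1)) := by
  choose f hf hr using h
  let s : ℕ → Subtype p := Nat.rec ⟨a, ha⟩ fun _ b => ⟨f b.1 b.2, hf b.1 b.2⟩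
  exact ⟨fun n => (s n).1, rfl, fun n => (s n).2, fun n => hr _ (s n).2⟩

lemma exists_int_seq {T : Type*} {p q : T → Prop} {r r' : T → T → Prop}
    (hqp : ∀ a, q a → p a) (hp : ∀ a, p a → ∃ b, p b ∧ r b a) (hq : ∀ a, q a → ∃ b, q b ∧ r' a b)
    {a : T} (ha : q a) :
    ∃ s : ℤ → T, s 0 = a ∧ (∀ i, p (s i)) ∧ (∀ i ≥ 0, r (s (i + 1)) (s i)) ∧
      ∀ i < 0, r' (s (i + 1)) (s i) := by
  obtain ⟨s, rfl, hs, hrs⟩ := exists_nat_seq hp (hqp a ha)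
  obtain ⟨t, ht₀, ht, hrt⟩ := exists_nat_seq hq ha
  refine ⟨fun | .ofNat n => s n | .negSucc n => t (n + 1), rfl, ?_, ?_, ?_⟩
  · rintro (n | n)
    exacts [hs n, hqp _ (ht _)]
  · rintro (n | n) hn
    exacts [hrs n, absurd hn (Int.negSucc_lt_zero n).not_ge]
  · rintro (n | _ | n) hn
    exacts [absurd hn (Int.natCast_nonneg n).not_gt, (congrArg (r' · (t 1)) ht₀).mp (hrt 0),
      hrt (n + 1)]

end Splice

section Resolution

variable {A : Type*} [Category A] [Abelian A]

lemma ExactResolution.isExtension_kernelObj {X : A} (E : ExactResolution X) :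
    ∀ i, IsExtension (E.kernelObj (i + 1)) (E.G.X i) (E.kernelObj i)
  | 0 => have := E.epi_ε; .of_epi E.ε
  | 1 => .kernel_of_exact E.exact_zero
  | i + 2 => .kernel_of_exact
      ((E.G.exactAt_iff' (i + 2) (i + 1) i (by simp) (by simp)).1 (E.exact_succ i))

/-- There is an exact sequence `⋯ ⟶ G 1 ⟶ G 0 ⟶ X ⟶ 0` with `G i` in the class `p i`. Varying the
class allows finite resolutions and resolutions of mixed type. -/
def HasExactResolution (p : ℕ → ObjectProperty A) (X : A) : Prop :=
  ∃ E : ExactResolution X, ∀ i, p i (E.G.X i)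

section

variable {p : ℕ → ObjectProperty A} {X : A}

lemma hasExactResolution_iff_exists_seq :
    HasExactResolution p X ↔ ∃ K : ℕ → A, K 0 = X ∧ ∀ i, IsSyzygy (p i) (K (i + 1)) (K i) := by
  constructor
  · rintro ⟨E, hE⟩
    exact ⟨E.kernelObj, rfl, fun i => ⟨_, hE i, E.isExtension_kernelObj i⟩⟩
  · rintro ⟨K, rfl, hK⟩
    choose G hG hK using hK
    obtain ⟨E, hE⟩ := exists_exactResolution hK
    exact ⟨E, fun i => hE i ▸ hG i⟩

lemma hasExactResolution_iff_exists_isSyzygy :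
    HasExactResolution p X ↔
      ∃ K, IsSyzygy (p 0) K X ∧ HasExactResolution (fun i => p (i + 1)) K := by
  simp only [hasExactResolution_iff_exists_seq]
  constructor
  · rintro ⟨K, rfl, hK⟩
    exact ⟨K 1, hK 0, fun i => K (i + 1), rfl, fun i => hK (i + 1)⟩
  · rintro ⟨_, hX, K, rfl, hK⟩
    exact ⟨fun | 0 => X | i + 1 => K i, rfl, fun | 0 => hX | i + 1 => hK i⟩

lemma HasExactResolution.mono {q : ℕ → ObjectProperty A} (hpq : p ≤ q)
    (h : HasExactResolution p X) : HasExactResolution q X := by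
  obtain ⟨E, hE⟩ := h
  exact ⟨E, fun i => hpq i _ (hE i)⟩

lemma HasExactResolution.of_isZero (hp : ∀ i, p i X) (hX : IsZero X) : HasExactResolution p X :=
  hasExactResolution_iff_exists_seq.2 ⟨fun _ => X, rfl, fun i => ⟨X, hp i, .of_isZero_left X hX⟩⟩

lemma HasExactResolution.of_forall_exists_isSyzygy {P : ObjectProperty A}
    (hP : ∀ X, ∃ K, IsSyzygy P K X) (X : A) : HasExactResolution (fun _ => P) X := by
  choose K hK using hP
  exact hasExactResolution_iff_exists_seq.2 ⟨fun i => K^[i] X, rfl, fun i => by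
    simpa only [Function.iterate_succ_apply'] using hK (K^[i] X)⟩

end

variable {P : ObjectProperty A} {X : A} {n : ℕ}

lemma hasResolutionOfLength_iff : HasResolutionOfLength P X n ↔
    HasExactResolution (fun i Y => (i ≤ n → P Y) ∧ (n < i → IsZero Y)) X := by
  simp only [HasResolutionOfLength, HasExactResolution, forall_and, gt_iff_lt]

lemma hasResolutionOfLength_succ_iff : HasResolutionOfLength P X (n + 1) ↔
    ∃ K, IsSyzygy P K X ∧ HasResolutionOfLength P K n := by
  simp only [hasResolutionOfLength_iff]
  rw [hasExactResolution_iff_exists_isSyzygy]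
  simp only [zero_le, forall_const, not_lt_zero, IsEmpty.forall_iff, and_true,
    add_le_add_iff_right, add_lt_add_iff_right]

lemma hasResolutionOfLength_zero_iff [P.IsClosedUnderIsomorphisms] :
    HasResolutionOfLength P X 0 ↔ P X := by
  rw [hasResolutionOfLength_iff, hasExactResolution_iff_exists_isSyzygy]
  constructor
  · rintro ⟨K, ⟨Y, hY, hK⟩, hK'⟩
    obtain ⟨_, ⟨Z, hZ, f, g, w, h⟩, -⟩ := hasExactResolution_iff_exists_isSyzygy.1 hK'
    have : Epi g := h.epi_g
    obtain ⟨e⟩ := hK.nonempty_iso_of_isZero_left ((hZ.2 one_pos).of_epi g)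
    exact P.prop_of_iso e (hY.1 le_rfl)
  · exact fun hX => ⟨0, ⟨X, by simpa using hX, .of_isZero_left X (isZero_zero A)⟩,
      .of_isZero (fun _ => by simpa using isZero_zero A) (isZero_zero A)⟩

lemma hasResolutionOfLength_of_syzygies {P : ObjectProperty A} [P.IsClosedUnderIsomorphisms]
    {K : ℕ → A} (hK : ∀ i, IsSyzygy P (K (i + 1)) (K i)) (hn : P (K n)) :
    HasResolutionOfLength P (K 0) n := by
  induction n generalizing K with
  | zero => exact hasResolutionOfLength_zero_iff.2 hn
  | succ n ih =>
    exact hasResolutionOfLength_succ_iff.2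
      ⟨K 1, hK 0, ih (K := fun i => K (i + 1)) (fun i => hK (i + 1)) hn⟩

lemma HasResolutionOfLength.mono (hP : ∀ X, IsZero X → P X) {m : ℕ} (hmn : m ≤ n)
    (h : HasResolutionOfLength P X m) : HasResolutionOfLength P X n := by
  rw [hasResolutionOfLength_iff] at h ⊢
  exact h.mono fun i Y hY =>
    ⟨fun _ => (le_or_gt i m).elim hY.1 fun hi => hP _ (hY.2 hi), fun _ => hY.2 (by lia)⟩

lemma HasResolutionOfLength.resDim_le (h : HasResolutionOfLength P X n) : resDim P X ≤ n :=
  iInf₂_le n h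

lemma resDim_lt_top_iff : resDim P X < ⊤ ↔ ∃ n, HasResolutionOfLength P X n := by
  simp [resDim, iInf_lt_top]

lemma resDim_le_iff (hP : ∀ X, IsZero X → P X) :
    resDim P X ≤ n ↔ HasResolutionOfLength P X n := by
  refine ⟨fun h => ?_, HasResolutionOfLength.resDim_le⟩
  have h' : resDim P X < (n + 1 : ℕ) := h.trans_lt (by exact_mod_cast Nat.lt_succ_self n)
  simp only [resDim, iInf_lt_iff] at h'
  obtain ⟨m, hm, hmn⟩ := h'
  exact hm.mono hP (Nat.lt_succ_iff.1 (by exact_mod_cast hmn))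

end Resolution

section GorensteinProj

variable {A : Type*} [Category A] [Abelian A]

lemma isHomExact_iff {E : ChainComplex A ℤ} {ℋ : ObjectProperty A} :
    IsHomExact E ℋ ↔ ∀ H, ℋ H → ∀ (i : ℤ) (g : E.X (i + 1) ⟶ H), E.d (i + 1 + 1) (i + 1) ≫ g = 0 →
      ∃ h : E.X i ⟶ H, E.d (i + 1) i ≫ h = g := by
  refine forall₂_congr fun H _ => ⟨fun h i => ?_, fun h i => ?_⟩
  · have h' := h (i + 1)
    rwa [add_sub_cancel_right] at h'
  · obtain ⟨i, rfl⟩ : ∃ j, i = j + 1 := ⟨i - 1, by lia⟩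
    rw [add_sub_cancel_right]
    exact h i

section Splice

variable {K E : ℤ → A} {ι : ∀ i, K (i + 1) ⟶ E i} {π : ∀ i, E i ⟶ K i} {w : ∀ i, ι i ≫ π i = 0}

lemma acyclic_splice (h : ∀ i, (ShortComplex.mk _ _ (w i)).ShortExact) : (splice w).Acyclic :=
  fun i => by simpa using exactAt_splice h (i - 1)

lemma isHomExact_splice [HasExt.{w} A] (h : ∀ i, (ShortComplex.mk _ _ (w i)).ShortExact)
    {ℋ : ObjectProperty A} (hK : ∀ i, extPerp.{w} ℋ (K i)) : IsHomExact (splice w) ℋ := by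
  refine isHomExact_iff.2 fun H hH i (g : E (i + 1) ⟶ H) hg => ?_
  have : Epi (π (i + 1 + 1)) := (h (i + 1 + 1)).epi_g
  have : Epi (π (i + 1)) := (h (i + 1)).epi_g
  have hg : (π (i + 1 + 1) ≫ ι (i + 1)) ≫ g = 0 := by rwa [splice_d] at hg
  rw [Category.assoc, ← comp_zero, cancel_epi] at hg
  obtain ⟨l, hl⟩ := exists_comp_eq_of_subsingleton_ext (h i) (hK i H hH 0)
    ((h (i + 1)).exact.desc g hg)
  have hl' : (π (i + 1) ≫ ι i) ≫ l = g := by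
    rw [Category.assoc, hl]
    exact (h (i + 1)).exact.g_desc g hg
  exact ⟨l, by rwa [splice_d]⟩

lemma nonempty_iso_image_splice (h : ∀ i, (ShortComplex.mk _ _ (w i)).ShortExact) {i j : ℤ}
    (hij : j + 1 = i) : Nonempty (K i ≅ image ((splice w).d i j)) := by
  subst hij
  have : Epi (π (j + 1)) := (h (j + 1)).epi_g
  have : Mono (ι j) := (h j).mono_f
  have := strongEpi_of_epi (π (j + 1))
  have e : K (j + 1) ≅ image (π (j + 1) ≫ ι j) := image.isoStrongEpiMono _ _ rfl
  exact ⟨e ≪≫ eqToIso (by rw [splice_d]; rfl)⟩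

end Splice

lemma comp_factorThruImage_eq_zero {X Y Z : A} {f : X ⟶ Y} {g : Y ⟶ Z} (w : f ≫ g = 0) :
    f ≫ factorThruImage g = 0 := by
  rw [← cancel_mono (image.ι g), Category.assoc, image.fac, w, zero_comp]

lemma imageι_comp_factorThruImage_eq_zero {X Y Z : A} {f : X ⟶ Y} {g : Y ⟶ Z} (w : f ≫ g = 0) :
    image.ι f ≫ factorThruImage g = 0 := by
  rw [← cancel_epi (factorThruImage f), image.fac_assoc, comp_factorThruImage_eq_zero w, comp_zero]

lemma shortExact_image {X Y Z : A} {f : X ⟶ Y} {g : Y ⟶ Z} {w : f ≫ g = 0}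
    (h : (ShortComplex.mk f g w).Exact) :
    (ShortComplex.mk (image.ι f) (factorThruImage g)
      (imageι_comp_factorThruImage_eq_zero w)).ShortExact where
  exact := (exact_epi_comp_mono_iff (factorThruImage f) _ _ (image.ι g) _ (by simp [w])).1
    (by simpa only [image.fac] using h)

section

variable {E : ChainComplex A ℤ}

lemma exact_of_acyclic (hE : E.Acyclic) (i : ℤ) :
    (ShortComplex.mk (E.d (i + 1 + 1) (i + 1)) (E.d (i + 1) i) (E.d_comp_d _ _ _)).Exact :=
  (E.exactAt_iff' (i + 1 + 1) (i + 1) i (by simp) (by simp)).1 (hE (i + 1))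

lemma isExtension_image (hE : E.Acyclic) (i : ℤ) :
    IsExtension (image (E.d (i + 1 + 1) (i + 1))) (E.X (i + 1))
      (image (E.d (i + 1) i)) :=
  ⟨_, _, _, shortExact_image (exact_of_acyclic hE i)⟩

variable [HasExt.{w} A]

lemma extPerp_image {ℋ : ObjectProperty A} (hE : E.Acyclic) (hH : IsHomExact E ℋ)
    (hX : ∀ i, extPerp.{w} ℋ (E.X i)) {i j : ℤ}
    (hij : j + 1 = i) : extPerp.{w} ℋ (image (E.d i j)) := by
  subst hij
  intro H hHH n
  induction n generalizing j with
  | zero =>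
    refine subsingleton_ext_one_of_forall_exists_comp_eq
      (shortExact_image (exact_of_acyclic hE j)) (hX (j + 1) H hHH 0) fun k => ?_
    obtain ⟨l, hl⟩ := isHomExact_iff.1 hH H hHH (j + 1) (factorThruImage _ ≫ k) (by
      rw [← Category.assoc, comp_factorThruImage_eq_zero (E.d_comp_d _ _ _), zero_comp])
    refine ⟨l, ?_⟩
    rw [← cancel_epi (factorThruImage _), ← hl, ← Category.assoc, image.fac]
  | succ n ih => exact (isExtension_image hE j).subsingleton_ext_right ih (hX _ H hHH (n + 1))

end

/-- The Gorenstein projective objects relative to `(𝒜, 𝒬, ℋ)`: the images of `E 0 ⟶ E (-1)` for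
the exact complexes `E` that stay exact under `Hom(-, ℋ)`, with terms in `𝒜` in degrees `≥ 0` and
in `𝒬` in degrees `< 0`. The `D_C`-projective complexes are those relative to the projective,
`C`-projective and `C`-flat complexes. -/
def gorensteinProj (𝒜 𝒬 ℋ : ObjectProperty A) : ObjectProperty A :=
  fun X => ∃ E : ChainComplex A ℤ, E.Acyclic ∧ IsHomExact E ℋ ∧
    (∀ i : ℤ, 0 ≤ i → 𝒜 (E.X i)) ∧ (∀ i : ℤ, i < 0 → 𝒬 (E.X i)) ∧
    Nonempty (X ≅ image (E.d 0 (-1)))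

instance {𝒜 𝒬 ℋ : ObjectProperty A} : (gorensteinProj 𝒜 𝒬 ℋ).IsClosedUnderIsomorphisms where
  of_iso e := fun ⟨E, h₁, h₂, h₃, h₄, ⟨i⟩⟩ => ⟨E, h₁, h₂, h₃, h₄, ⟨e.symm ≪≫ i⟩⟩

end GorensteinProj

section IsAdmissible

variable {A : Type*} [Category A] [Abelian A] [HasExt.{w} A]

/-- The properties of `(𝒜, 𝒬, ℋ)` on which the theory of `gorensteinProj 𝒜 𝒬 ℋ` rests: `𝒜` is a
class of projective objects with enough objects, and `𝒬` is a class of objects of `ℋ` without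
higher extensions by objects of `ℋ`. -/
structure IsAdmissible (𝒜 𝒬 ℋ : ObjectProperty A) : Prop where
  projective : ∀ X, 𝒜 X → Projective X
  exists_isSyzygy : ∀ X, ∃ K, IsSyzygy 𝒜 K X
  le : 𝒬 ≤ ℋ
  le_extPerp : 𝒬 ≤ extPerp.{w} ℋ
  of_isZero : ∀ X, IsZero X → 𝒬 X
  biprod : ∀ X Y, 𝒬 X → 𝒬 Y → 𝒬 (X ⊞ Y)
  of_iso : ∀ X Y, (X ≅ Y) → 𝒬 X → 𝒬 Y

variable {𝒜 𝒬 ℋ : ObjectProperty A}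

lemma extPerp_mid {X Y Z : A} (hY : IsExtension X Y Z) (hX : extPerp.{w} ℋ X)
    (hZ : extPerp.{w} ℋ Z) : extPerp.{w} ℋ Y :=
  fun H hH => .mid hY (hX H hH) (hZ H hH)

lemma extPerp_left {X Y Z : A} (h : IsExtension X Y Z) (hY : extPerp.{w} ℋ Y)
    (hZ : extPerp.{w} ℋ Z) : extPerp.{w} ℋ X :=
  fun H hH => .left h (hY H hH) (hZ H hH)

namespace IsAdmissible

variable {X Y Z : A} (h : IsAdmissible.{w} 𝒜 𝒬 ℋ)

include h

lemma projective_le_extPerp : 𝒜 ≤ extPerp.{w} ℋ := fun X hX _ _ =>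
  have := h.projective X hX
  .of_projective

lemma extPerp_X {E : ChainComplex A ℤ} (h𝒜 : ∀ i, 0 ≤ i → 𝒜 (E.X i))
    (h𝒬 : ∀ i, i < 0 → 𝒬 (E.X i)) (i : ℤ) : extPerp.{w} ℋ (E.X i) := by
  obtain hi | hi := le_or_gt 0 i
  exacts [h.projective_le_extPerp _ (h𝒜 i hi), h.le_extPerp _ (h𝒬 i hi)]

lemma extPerp_of_gorensteinProj (hX : gorensteinProj 𝒜 𝒬 ℋ X) : extPerp.{w} ℋ X := by
  obtain ⟨E, hE, hE', h𝒜, h𝒬, ⟨e⟩⟩ := hX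
  have hI := extPerp_image hE hE' (h.extPerp_X h𝒜 h𝒬) (neg_add_cancel 1)
  exact fun H hH => (hI H hH).of_iso e.symm

/-- The objects of `extPerp ℋ` have a left half of a complete resolution anyway, so only the right
half has to be constructed. -/
theorem gorensteinProj_of_coresolving {W : ObjectProperty A} (hW : W ≤ extPerp.{w} ℋ)
    (h𝒬 : ∀ X, W X → ∃ Y, W Y ∧ IsSyzygy 𝒬 X Y) (hX : W X) : gorensteinProj 𝒜 𝒬 ℋ X := by
  have h𝒜 (X : A) (hX : extPerp.{w} ℋ X) : ∃ K, extPerp.{w} ℋ K ∧ IsSyzygy 𝒜 K X := by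
    obtain ⟨K, P, hP, hK⟩ := h.exists_isSyzygy X
    exact ⟨K, extPerp_left hK (h.projective_le_extPerp _ hP) hX, P, hP, hK⟩
  obtain ⟨K, rfl, hK, hK𝒜, hK𝒬⟩ := exists_int_seq hW h𝒜 h𝒬 hX
  have hsyz (i : ℤ) : ∃ E, ((0 ≤ i → 𝒜 E) ∧ (i < 0 → 𝒬 E)) ∧ IsExtension (K (i + 1)) E (K i) := by
    obtain hi | hi := le_or_gt 0 i
    · obtain ⟨E, hE, hKE⟩ := hK𝒜 i hi
      exact ⟨E, ⟨fun _ => hE, fun hi' => absurd hi hi'.not_ge⟩, hKE⟩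
    · obtain ⟨E, hE, hKE⟩ := hK𝒬 i hi
      exact ⟨E, ⟨fun hi' => absurd hi hi'.not_gt, fun _ => hE⟩, hKE⟩
  choose E hE ι π w hs using hsyz
  exact ⟨splice w, acyclic_splice hs, isHomExact_splice hs hK, fun i => (hE i).1,
    fun i => (hE i).2, nonempty_iso_image_splice hs (neg_add_cancel 1)⟩

lemma exists_isSyzygy_of_gorensteinProj (hX : gorensteinProj 𝒜 𝒬 ℋ X) :
    ∃ Y, gorensteinProj 𝒜 𝒬 ℋ Y ∧ IsSyzygy 𝒬 X Y := by
  obtain ⟨E, hE, hE', h𝒜, h𝒬, hXE⟩ := hX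
  let W : ObjectProperty A := fun Y =>
    ∃ i j : ℤ, j + 1 = i ∧ j < 0 ∧ Nonempty (Y ≅ image (E.d i j))
  have hW : W ≤ extPerp.{w} ℋ := by
    rintro Y ⟨i, j, hij, -, ⟨e⟩⟩ H hH
    exact .of_iso (extPerp_image hE hE' (h.extPerp_X h𝒜 h𝒬) hij H hH) e.symm
  have hW𝒬 (Y : A) (hY : W Y) : ∃ Z, W Z ∧ IsSyzygy 𝒬 Y Z := by
    obtain ⟨_, j, rfl, hj, ⟨e⟩⟩ := hY
    obtain ⟨i, rfl⟩ : ∃ i, j = i + 1 := ⟨j - 1, by lia⟩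
    exact ⟨_, ⟨i + 1, i, rfl, by lia, ⟨.refl _⟩⟩, E.X (i + 1), h𝒬 _ hj,
      (isExtension_image hE i).of_iso e.symm (.refl _) (.refl _)⟩
  obtain ⟨Y, hY, hXY⟩ := hW𝒬 X ⟨0, -1, neg_add_cancel 1, neg_one_lt_zero, hXE⟩
  exact ⟨Y, h.gorensteinProj_of_coresolving hW hW𝒬 hY, hXY⟩

lemma le_gorensteinProj : 𝒬 ≤ gorensteinProj 𝒜 𝒬 ℋ := fun _ hX =>
  h.gorensteinProj_of_coresolving h.le_extPerp
    (fun X hX => ⟨0, h.of_isZero 0 (isZero_zero A), X, hX, .of_isZero_right X (isZero_zero A)⟩) hX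

lemma gorensteinProj_of_isZero (X : A) (hX : IsZero X) : gorensteinProj 𝒜 𝒬 ℋ X :=
  h.le_gorensteinProj X (h.of_isZero X hX)

lemma gorensteinProj_of_isSyzygy (hX : extPerp.{w} ℋ X) (hXY : IsSyzygy 𝒬 X Y)
    (hY : gorensteinProj 𝒜 𝒬 ℋ Y) : gorensteinProj 𝒜 𝒬 ℋ X := by
  refine h.gorensteinProj_of_coresolving
    (W := fun X => extPerp.{w} ℋ X ∧ ∃ Y, gorensteinProj 𝒜 𝒬 ℋ Y ∧ IsSyzygy 𝒬 X Y)
    (fun _ hX => hX.1) ?_ ⟨hX, Y, hY, hXY⟩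
  rintro X ⟨-, Y, hY, hXY⟩
  exact ⟨Y, ⟨h.extPerp_of_gorensteinProj hY, h.exists_isSyzygy_of_gorensteinProj hY⟩, hXY⟩

lemma exists_isSyzygy_of_isExtension {X' Z' : A} (hY : IsExtension X Y Z)
    (hX : IsSyzygy 𝒬 X X') (hZ : IsSyzygy 𝒬 Z Z') (hZperp : extPerp.{w} ℋ Z) :
    ∃ Y', IsSyzygy 𝒬 Y Y' ∧ IsExtension X' Y' Z' := by
  obtain ⟨E, hE, hXE⟩ := hX
  obtain ⟨F, hF, hZF⟩ := hZ
  obtain ⟨T, hET, hYT⟩ := hY.exists_pushout_mono hXE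
  -- `T ≅ E ⊞ Z`, so the embedding of `Z` into `F` extends to one of `T` into `E ⊞ F`.
  have hTE : IsExtension Z T E := hET.swap (hZperp E (h.le _ hE) 0)
  obtain ⟨P, hFP, hTP⟩ := hTE.exists_pushout_mono hZF
  obtain ⟨e⟩ := hFP.nonempty_iso_biprod (h.le_extPerp _ hE F (h.le _ hF) 0)
  obtain ⟨Y', hX'Y', hYP⟩ := hTP.exists_pushout_epi hYT
  exact ⟨Y', ⟨P, h.of_iso _ _ e.symm (h.biprod F E hF hE), hYP⟩, hX'Y'⟩

lemma gorensteinProj_mid (hY : IsExtension X Y Z) (hX : gorensteinProj 𝒜 𝒬 ℋ X)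
    (hZ : gorensteinProj 𝒜 𝒬 ℋ Z) : gorensteinProj 𝒜 𝒬 ℋ Y := by
  refine h.gorensteinProj_of_coresolving (W := fun Y => ∃ X Z, IsExtension X Y Z ∧
    gorensteinProj 𝒜 𝒬 ℋ X ∧ gorensteinProj 𝒜 𝒬 ℋ Z) ?_ ?_ ⟨X, Z, hY, hX, hZ⟩
  · rintro Y ⟨X, Z, hY, hX, hZ⟩
    exact extPerp_mid hY (h.extPerp_of_gorensteinProj hX) (h.extPerp_of_gorensteinProj hZ)
  · rintro Y ⟨X, Z, hY, hX, hZ⟩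
    obtain ⟨X', hX', hXX'⟩ := h.exists_isSyzygy_of_gorensteinProj hX
    obtain ⟨Z', hZ', hZZ'⟩ := h.exists_isSyzygy_of_gorensteinProj hZ
    obtain ⟨Y', hYY', hY'⟩ :=
      h.exists_isSyzygy_of_isExtension hY hXX' hZZ' (h.extPerp_of_gorensteinProj hZ)
    exact ⟨Y', ⟨X', Z', hY', hX', hZ'⟩, hYY'⟩

lemma gorensteinProj_left (hY : IsExtension X Y Z) (hYG : gorensteinProj 𝒜 𝒬 ℋ Y)
    (hZ : gorensteinProj 𝒜 𝒬 ℋ Z) : gorensteinProj 𝒜 𝒬 ℋ X := by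
  obtain ⟨Y', hY', E, hE, hYE⟩ := h.exists_isSyzygy_of_gorensteinProj hYG
  obtain ⟨P, hZP, hXE⟩ := hYE.exists_pushout_epi hY
  exact h.gorensteinProj_of_isSyzygy
    (extPerp_left hY (h.extPerp_of_gorensteinProj hYG) (h.extPerp_of_gorensteinProj hZ))
    ⟨E, hE, hXE⟩ (h.gorensteinProj_mid hZP hZ hY')

end IsAdmissible

end IsAdmissible

section AuslanderBuchweitz

variable {A : Type*} [Category A] [Abelian A] [HasExt.{w} A] {𝒜 𝒬 ℋ : ObjectProperty A}
  {X Y Z : A} {m n : ℕ}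

lemma subsingleton_ext_of_hasResolutionOfLength_right [ℋ.IsClosedUnderIsomorphisms]
    (hX : ∀ m, n < m → ∀ H, ℋ H → Subsingleton (Abelian.Ext.{w} X H m)) {H : A} {k : ℕ}
    (hH : HasResolutionOfLength ℋ H k) (hm : n < m) : Subsingleton (Abelian.Ext.{w} X H m) := by
  induction k generalizing H m with
  | zero => exact hX m hm H (hasResolutionOfLength_zero_iff.1 hH)
  | succ k ih =>
    obtain ⟨K, ⟨G, hG, hK⟩, hKk⟩ := hasResolutionOfLength_succ_iff.1 hH
    exact hK.subsingleton_ext_covariant_right (hX m hm G hG) (ih hKk (by lia))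

namespace IsAdmissible

variable (h : IsAdmissible.{w} 𝒜 𝒬 ℋ)

include h

lemma gorensteinProj_of_hasResolutionOfLength
    (hX : HasResolutionOfLength (gorensteinProj 𝒜 𝒬 ℋ) X n) (hXperp : extPerp.{w} ℋ X) :
    gorensteinProj 𝒜 𝒬 ℋ X := by
  induction n generalizing X with
  | zero => exact hasResolutionOfLength_zero_iff.1 hX
  | succ n ih =>
    obtain ⟨K, ⟨G, hG, hK⟩, hKn⟩ := hasResolutionOfLength_succ_iff.1 hX
    have hKG := ih hKn (extPerp_left hK (h.extPerp_of_gorensteinProj hG) hXperp)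
    obtain ⟨K', hK', E, hE, hKE⟩ := h.exists_isSyzygy_of_gorensteinProj hKG
    obtain ⟨T, hET, hGT⟩ := hK.exists_pushout_mono hKE
    -- `T ≅ E ⊞ X`, so that `X` is the kernel of an epimorphism from `T` onto `E`.
    exact h.gorensteinProj_left (hET.swap (hXperp E (h.le _ hE) 0))
      (h.gorensteinProj_mid hGT hG hK') (h.le_gorensteinProj _ hE)

lemma subsingleton_ext_of_hasResolutionOfLength
    (hX : HasResolutionOfLength (gorensteinProj 𝒜 𝒬 ℋ) X n) (hm : n < m) {H : A} (hH : ℋ H) :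
    Subsingleton (Abelian.Ext.{w} X H m) := by
  obtain ⟨m, rfl⟩ := Nat.exists_eq_add_one_of_ne_zero (Nat.ne_zero_of_lt hm)
  induction n generalizing X m with
  | zero => exact h.extPerp_of_gorensteinProj (hasResolutionOfLength_zero_iff.1 hX) H hH m
  | succ n ih =>
    obtain ⟨K, ⟨G, hG, hK⟩, hKn⟩ := hasResolutionOfLength_succ_iff.1 hX
    obtain ⟨m, rfl⟩ := Nat.exists_eq_add_one_of_ne_zero (show m ≠ 0 by lia)
    exact hK.subsingleton_ext_right (ih hKn m (by lia))
      (h.extPerp_of_gorensteinProj hG H hH (m + 1))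

lemma hasResolutionOfLength_left (hY : IsExtension X Y Z)
    (hYn : HasResolutionOfLength (gorensteinProj 𝒜 𝒬 ℋ) Y n) (hZ : gorensteinProj 𝒜 𝒬 ℋ Z) :
    HasResolutionOfLength (gorensteinProj 𝒜 𝒬 ℋ) X n := by
  cases n with
  | zero =>
    rw [hasResolutionOfLength_zero_iff] at hYn ⊢
    exact h.gorensteinProj_left hY hYn hZ
  | succ n =>
    obtain ⟨K, ⟨G, hG, hK⟩, hKn⟩ := hasResolutionOfLength_succ_iff.1 hYn
    obtain ⟨M, hKM, hMG⟩ := hK.exists_pullback_mono hY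
    exact hasResolutionOfLength_succ_iff.2 ⟨K, ⟨M, h.gorensteinProj_left hMG hG hZ, hKM⟩, hKn⟩

lemma exists_approximation (hX : HasResolutionOfLength (gorensteinProj 𝒜 𝒬 ℋ) X n) :
    ∃ K, IsSyzygy (gorensteinProj 𝒜 𝒬 ℋ) K X ∧
      HasExactResolution (fun i Y => (i < n → 𝒬 Y) ∧ (n ≤ i → IsZero Y)) K := by
  induction n generalizing X with
  | zero =>
    have hX := hasResolutionOfLength_zero_iff.1 hX
    exact ⟨0, ⟨X, hX, .of_isZero_left X (isZero_zero A)⟩,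
      .of_isZero (fun i => ⟨by simp, fun _ => isZero_zero A⟩) (isZero_zero A)⟩
  | succ n ih =>
    obtain ⟨X', ⟨G₀, hG₀, hX'⟩, hX'n⟩ := hasResolutionOfLength_succ_iff.1 hX
    obtain ⟨K, ⟨G, hG, hK⟩, hKn⟩ := ih hX'n
    obtain ⟨G', hG', E, hE, hGE⟩ := h.exists_isSyzygy_of_gorensteinProj hG
    obtain ⟨X'', hX'', hKE⟩ := hGE.exists_pushout_epi hK
    obtain ⟨T, hXT, hGT⟩ := hX'.exists_pushout_mono hX''
    refine ⟨X'', ⟨T, h.gorensteinProj_mid hGT hG₀ hG', hXT⟩,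
      hasExactResolution_iff_exists_isSyzygy.2 ⟨K, ⟨E, ⟨fun _ => hE, by simp⟩, hKE⟩, ?_⟩⟩
    simpa only [Nat.add_lt_add_iff_right, Nat.add_le_add_iff_right] using hKn

section

variable (h𝒜 : 𝒜 ≤ gorensteinProj 𝒜 𝒬 ℋ)

include h𝒜

lemma hasResolutionOfLength_mid (hY : IsExtension X Y Z)
    (hX : HasResolutionOfLength (gorensteinProj 𝒜 𝒬 ℋ) X n) (hZ : gorensteinProj 𝒜 𝒬 ℋ Z) :
    HasResolutionOfLength (gorensteinProj 𝒜 𝒬 ℋ) Y n := by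
  induction n generalizing X Y Z with
  | zero =>
    rw [hasResolutionOfLength_zero_iff] at hX ⊢
    exact h.gorensteinProj_mid hY hX hZ
  | succ n ih =>
    obtain ⟨K, ⟨G, hG, hK⟩, hKn⟩ := hasResolutionOfLength_succ_iff.1 hX
    obtain ⟨L, P, hP, hL⟩ := h.exists_isSyzygy Z
    have := h.projective P hP
    -- Pulled back along `P ⟶ Z`, the extension `Y` of `Z` by `X` becomes a split one, `T`.
    obtain ⟨T, hXT, hLT⟩ := hY.exists_pullback_epi hL
    have hPT : IsExtension P T X := hXT.swap (Abelian.Ext.subsingleton_of_projective _ _ _)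
    obtain ⟨U, hPU, hKU⟩ := hPT.exists_pullback_epi hK
    obtain ⟨M, hKM, hMU⟩ := hKU.exists_pullback_mono hLT
    exact hasResolutionOfLength_succ_iff.2 ⟨M, ⟨U, h.gorensteinProj_mid hPU (h𝒜 P hP) hG, hMU⟩,
      ih hKM hKn (h.gorensteinProj_left hL (h𝒜 P hP) hZ)⟩

lemma hasResolutionOfLength_of_isSyzygy (hXY : IsSyzygy (gorensteinProj 𝒜 𝒬 ℋ) X Y)
    (hY : HasResolutionOfLength (gorensteinProj 𝒜 𝒬 ℋ) Y (n + 1)) :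
    HasResolutionOfLength (gorensteinProj 𝒜 𝒬 ℋ) X n := by
  obtain ⟨E, hE, hXE⟩ := hXY
  obtain ⟨K, ⟨G, hG, hK⟩, hKn⟩ := hasResolutionOfLength_succ_iff.1 hY
  obtain ⟨T, hKT, hXT⟩ := hK.exists_pullback_epi hXE
  exact h.hasResolutionOfLength_left hXT (h.hasResolutionOfLength_mid h𝒜 hKT hKn hE) hG

lemma gorensteinProj_of_syzygies {K : ℕ → A}
    (hK : ∀ i, IsSyzygy (gorensteinProj 𝒜 𝒬 ℋ) (K (i + 1)) (K i))
    (hK₀ : HasResolutionOfLength (gorensteinProj 𝒜 𝒬 ℋ) (K 0) m)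
    (hext : ∀ m, n < m → ∀ H, ℋ H → Subsingleton (Abelian.Ext.{w} (K 0) H m)) :
    gorensteinProj 𝒜 𝒬 ℋ (K n) := by
  induction n generalizing K with
  | zero =>
    exact h.gorensteinProj_of_hasResolutionOfLength hK₀ fun H hH m => hext (m + 1) m.succ_pos H hH
  | succ n ih =>
    refine ih (K := fun i => K (i + 1)) (fun i => hK (i + 1)) ?_ fun m hm H hH => ?_
    · exact h.hasResolutionOfLength_of_isSyzygy h𝒜 (hK 0)
        (hK₀.mono h.gorensteinProj_of_isZero m.le_succ)
    · obtain ⟨G, hG, hKG⟩ := hK 0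
      obtain ⟨m, rfl⟩ := Nat.exists_eq_add_one_of_ne_zero (Nat.ne_zero_of_lt hm)
      exact hKG.subsingleton_ext_left (h.extPerp_of_gorensteinProj hG H hH m)
        (hext (m + 1 + 1) (by lia) H hH)

lemma exists_mixed_resolution {t : ℕ} (ht : t ≤ n)
    (hX : HasResolutionOfLength (gorensteinProj 𝒜 𝒬 ℋ) X n) :
    HasExactResolution (fun i Y => (i < t → 𝒜 Y) ∧ (i = t → gorensteinProj 𝒜 𝒬 ℋ Y) ∧
      (t < i → i ≤ n → 𝒬 Y) ∧ (n < i → IsZero Y)) X := by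
  induction t generalizing X n with
  | zero =>
    obtain ⟨K, ⟨G, hG, hK⟩, hKn⟩ := h.exists_approximation hX
    refine hasExactResolution_iff_exists_isSyzygy.2 ⟨K, ⟨G, by simp [hG], hK⟩, ?_⟩
    exact hKn.mono fun i Y hY => ⟨by simp, by simp, fun _ hi => hY.1 hi,
      fun hi => hY.2 (Nat.lt_succ_iff.1 hi)⟩
  | succ t ih =>
    obtain ⟨n, rfl⟩ := Nat.exists_eq_add_one_of_ne_zero (show n ≠ 0 by lia)
    obtain ⟨K, P, hP, hK⟩ := h.exists_isSyzygy X
    have hKn := h.hasResolutionOfLength_of_isSyzygy h𝒜 ⟨P, h𝒜 P hP, hK⟩ hX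
    refine hasExactResolution_iff_exists_isSyzygy.2 ⟨K, ⟨P, by simp [hP], hK⟩, ?_⟩
    simpa only [Nat.add_lt_add_iff_right, Nat.add_le_add_iff_right, Nat.add_right_cancel_iff]
      using ih (Nat.le_of_succ_le_succ ht) hKn

theorem tfae [ℋ.IsClosedUnderIsomorphisms] (X : A) (n : ℕ) :
    List.TFAE [
      resDim (gorensteinProj 𝒜 𝒬 ℋ) X ≤ n,
      resDim (gorensteinProj 𝒜 𝒬 ℋ) X < ⊤ ∧ ∀ m : ℕ, n < m → ∀ H : A, resDim ℋ H < ⊤ →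
        Subsingleton (Abelian.Ext.{w} X H m),
      resDim (gorensteinProj 𝒜 𝒬 ℋ) X < ⊤ ∧ ∀ m : ℕ, n < m → ∀ H : A, ℋ H →
        Subsingleton (Abelian.Ext.{w} X H m),
      ∀ E : ExactResolution X, (∀ i : ℕ, gorensteinProj 𝒜 𝒬 ℋ (E.G.X i)) →
        gorensteinProj 𝒜 𝒬 ℋ (E.kernelObj n),
      ∀ t : ℕ, t ≤ n → ∃ E : ExactResolution X,
        (∀ i : ℕ, i < t → 𝒜 (E.G.X i)) ∧
        gorensteinProj 𝒜 𝒬 ℋ (E.G.X t) ∧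
        (∀ i : ℕ, t < i → i ≤ n → 𝒬 (E.G.X i)) ∧
        ∀ i : ℕ, n < i → IsZero (E.G.X i)] := by
  tfae_have 1 → 2 := fun h₁ => ⟨h₁.trans_lt (ENat.natCast_lt_top n), fun m hm H hH => by
    obtain ⟨k, hk⟩ := resDim_lt_top_iff.1 hH
    rw [resDim_le_iff h.gorensteinProj_of_isZero] at h₁
    exact subsingleton_ext_of_hasResolutionOfLength_right
      (fun m hm H hH => h.subsingleton_ext_of_hasResolutionOfLength h₁ hm hH) hk hm⟩
  tfae_have 2 → 3 := fun ⟨h₁, h₂⟩ => ⟨h₁, fun m hm H hH => h₂ m hm H <|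
    resDim_lt_top_iff.2 ⟨0, hasResolutionOfLength_zero_iff.2 hH⟩⟩
  tfae_have 3 → 4 := fun ⟨h₁, h₂⟩ E hE => by
    obtain ⟨k, hk⟩ := resDim_lt_top_iff.1 h₁
    exact h.gorensteinProj_of_syzygies h𝒜 (fun i => ⟨_, hE i, E.isExtension_kernelObj i⟩) hk h₂
  tfae_have 4 → 1 := fun h₄ => by
    obtain ⟨E, hE⟩ := HasExactResolution.of_forall_exists_isSyzygy h.exists_isSyzygy X
    have hE' (i : ℕ) := h𝒜 _ (hE i)
    exact (hasResolutionOfLength_of_syzygies (fun i => ⟨_, hE' i, E.isExtension_kernelObj i⟩)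
      (h₄ E hE')).resDim_le
  tfae_have 1 → 5 := fun h₁ t ht => by
    obtain ⟨E, hE⟩ :=
      h.exists_mixed_resolution h𝒜 ht ((resDim_le_iff h.gorensteinProj_of_isZero).1 h₁)
    exact ⟨E, fun i => (hE i).1, (hE t).2.1 rfl, fun i => (hE i).2.2.1, fun i => (hE i).2.2.2⟩
  tfae_have 5 → 1 := fun h₅ => by
    obtain ⟨E, h₁, h₂, -, h₄⟩ := h₅ n le_rfl
    refine HasResolutionOfLength.resDim_le ⟨E, fun i hi => ?_, h₄⟩
    obtain hi | rfl := hi.lt_or_eq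
    exacts [h𝒜 _ (h₁ i hi), h₂]
  tfae_finish

end

end IsAdmissible

end AuslanderBuchweitz

section Disk

variable {B : Type*} [Category B] [Abelian B] {H : ChainComplex B ℤ} {M N L : ℤ → B}

lemma nonempty_cycles_splice_iso {α : Type*} [AddRightCancelSemigroup α] [One α] [DecidableEq α]
    {K E : α → B} {ι : ∀ i, K (i + 1) ⟶ E i} {π : ∀ i, E i ⟶ K i} {w : ∀ i, ι i ≫ π i = 0}
    (h : ∀ i, (ShortComplex.mk _ _ (w i)).ShortExact) (i : α) :
    Nonempty ((splice w).cycles (i + 1) ≅ K (i + 1 + 1)) :=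
  have : Mono (ι i) := (h i).mono_f
  ⟨((splice w).cyclesIsKernel (i + 1) i (ComplexShape.next_eq' _ rfl)).conePointUniqueUpToIso
    (isKernelCompMono (h (i + 1)).fIsKernel (ι i) (splice_d w i))⟩

lemma shortExact_cycles (hH : H.Acyclic) {i j : ℤ} (hij : j + 1 = i) :
    ∃ w, (ShortComplex.mk (H.iCycles i) (H.toCycles i j) w).ShortExact := by
  have : Epi (H.toCycles i j) := by
    rw [epi_iff_surjective_up_to_refinements]
    intro T z
    obtain ⟨T', p, hp, x, hx⟩ := (H.exactAt_iff_exact_up_to_refinements i j (j - 1)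
      (by simp [hij]) (by simp)).1 (hH j) (z ≫ H.iCycles j) (by simp)
    exact ⟨T', p, hp, x, by simpa [← cancel_mono (H.iCycles j)] using hx⟩
  have w : H.iCycles i ≫ H.toCycles i j = 0 := by simp [← cancel_mono (H.iCycles j)]
  refine ⟨w, ⟨ShortComplex.exact_of_f_is_kernel _ (KernelFork.IsLimit.ofι' _ _ fun k hk => ?_)⟩⟩
  have hk' : k ≫ H.d i j = 0 := by rw [← H.toCycles_i i j, reassoc_of% hk, zero_comp]
  exact ⟨H.liftCycles k j (ComplexShape.next_eq' _ hij) hk', by simp⟩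

lemma biprod_map_comp_eq_zero {X Y Z X' Y' Z' : B} {f : X ⟶ Y} {g : Y ⟶ Z} {f' : X' ⟶ Y'}
    {g' : Y' ⟶ Z'} (w : f ≫ g = 0) (w' : f' ≫ g' = 0) :
    biprod.map f f' ≫ biprod.map g g' = 0 := by
  ext <;> simp [w, w']

lemma shortExact_biprod_map {X Y Z X' Y' Z' : B} {f : X ⟶ Y} {g : Y ⟶ Z} {f' : X' ⟶ Y'}
    {g' : Y' ⟶ Z'} {w : f ≫ g = 0} {w' : f' ≫ g' = 0} (h : (ShortComplex.mk f g w).ShortExact)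
    (h' : (ShortComplex.mk f' g' w').ShortExact) :
    (ShortComplex.mk (biprod.map f f') (biprod.map g g')
      (biprod_map_comp_eq_zero w w')).ShortExact := by
  have : Mono f := h.mono_f
  have : Epi g := h.epi_g
  have : Mono f' := h'.mono_f
  have : Epi g' := h'.epi_g
  refine ⟨exact_of_forall_exists_desc _ fun k hk => ?_⟩
  have hk₁ : f ≫ biprod.inl ≫ k = 0 := by simpa using biprod.inl ≫= hk
  have hk₂ : f' ≫ biprod.inr ≫ k = 0 := by simpa using biprod.inr ≫= hk
  exact ⟨biprod.desc (h.exact.desc _ hk₁) (h'.exact.desc _ hk₂), biprod.hom_ext' _ _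
    (by simpa using h.exact.g_desc _ hk₁) (by simpa using h'.exact.g_desc _ hk₂)⟩

/-- The direct sum over `i` of the complexes `0 ⟶ M i ⟶ M i ⟶ 0` in degrees `i` and `i - 1`; its
term in degree `i` is `M (i + 1) ⊞ M i`. -/
noncomputable def disk (M : ℤ → B) : ChainComplex B ℤ :=
  splice (K := M) fun i => (biprod.inl_snd : (biprod.inl : M (i + 1) ⟶ M (i + 1) ⊞ M i) ≫ _ = 0)

lemma disk_d (M : ℤ → B) (i : ℤ) :
    (disk M).d (i + 1) i = (biprod.snd : M (i + 1 + 1) ⊞ M (i + 1) ⟶ _) ≫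
      (biprod.inl : M (i + 1) ⟶ M (i + 1) ⊞ M i) :=
  splice_d _ i

lemma acyclic_disk (M : ℤ → B) : (disk M).Acyclic :=
  acyclic_splice fun _ => shortExact_biprod _ _

lemma nonempty_cycles_disk_iso (M : ℤ → B) (i : ℤ) :
    Nonempty ((disk M).cycles i ≅ M (i + 1)) := by
  obtain ⟨j, rfl⟩ : ∃ j, i = j + 1 := ⟨i - 1, by ring⟩
  exact nonempty_cycles_splice_iso (fun _ => shortExact_biprod _ _) j

/-- The inclusion of the generator `M i` of `disk M` in degree `i`. -/
noncomputable def diskι (M : ℤ → B) (i : ℤ) : M i ⟶ (disk M).X i :=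
  (biprod.inr : M i ⟶ M (i + 1) ⊞ M i)

lemma disk_hom_ext {f g : disk M ⟶ H} (h : ∀ i, diskι M i ≫ f.f i = diskι M i ≫ g.f i) :
    f = g := by
  refine HomologicalComplex.hom_ext _ _ fun i =>
    biprod.hom_ext' (X := M (i + 1)) (Y := M i) (f.f i) (g.f i) ?_ (h i)
  have hd : (biprod.inl : M (i + 1) ⟶ M (i + 1) ⊞ M i) =
      diskι M (i + 1) ≫ (disk M).d (i + 1) i := by
    rw [disk_d]
    exact (biprod.inr_snd_assoc _).symm
  have key (k : disk M ⟶ H) : (diskι M (i + 1) ≫ (disk M).d (i + 1) i) ≫ k.f i =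
      (diskι M (i + 1) ≫ k.f (i + 1)) ≫ H.d (i + 1) i := by
    rw [Category.assoc, Category.assoc, k.comm]
  rw [hd]
  exact (key f).trans ((congrArg (· ≫ _) (h (i + 1))).trans (key g).symm)

/-- The morphism out of `disk M` determined by its values on the generators. -/
noncomputable def diskDesc (g : ∀ i, M i ⟶ H.X i) : disk M ⟶ H where
  f i := biprod.desc (g (i + 1) ≫ H.d (i + 1) i) (g i)
  comm' := by
    rintro _ i rfl
    have h : biprod.desc (g (i + 1 + 1) ≫ H.d (i + 1 + 1) (i + 1)) (g (i + 1)) ≫ H.d (i + 1) i =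
        (biprod.snd ≫ biprod.inl) ≫ biprod.desc (g (i + 1) ≫ H.d (i + 1) i) (g i) := by
      ext <;> simp
    exact h.trans (congrArg (· ≫ _) (disk_d M i).symm)

lemma diskι_diskDesc (g : ∀ i, M i ⟶ H.X i) (i : ℤ) : diskι M i ≫ (diskDesc g).f i = g i :=
  biprod.inr_desc _ _

/-- The morphism of complexes `disk M ⟶ disk N` induced by morphisms `M i ⟶ N i`. -/
noncomputable def diskMap (φ : ∀ i, M i ⟶ N i) : disk M ⟶ disk N where
  f i := biprod.map (φ (i + 1)) (φ i)
  comm' := by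
    rintro _ i rfl
    have h : biprod.map (φ (i + 1 + 1)) (φ (i + 1)) ≫ biprod.snd ≫ biprod.inl =
        (biprod.snd ≫ biprod.inl) ≫ biprod.map (φ (i + 1)) (φ i) := by
      ext <;> simp
    exact (congrArg (_ ≫ ·) (disk_d N i)).trans (h.trans (congrArg (· ≫ _) (disk_d M i).symm))

lemma diskι_diskMap (φ : ∀ i, M i ⟶ N i) (i : ℤ) :
    diskι M i ≫ (diskMap φ).f i = φ i ≫ diskι N i :=
  biprod.inr_map _ _

lemma shortExact_diskMap {f : ∀ i, M i ⟶ N i} {g : ∀ i, N i ⟶ L i} {w : ∀ i, f i ≫ g i = 0}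
    (h : ∀ i, (ShortComplex.mk _ _ (w i)).ShortExact) :
    ∃ w', (ShortComplex.mk (diskMap f) (diskMap g) w').ShortExact := by
  have hi (i : ℤ) := shortExact_biprod_map (h (i + 1)) (h i)
  exact ⟨HomologicalComplex.hom_ext _ _ fun i => biprod_map_comp_eq_zero (w (i + 1)) (w i),
    HomologicalComplex.shortExact_of_degreewise_shortExact _ hi⟩

lemma IsExtension.disk (h : ∀ i, IsExtension (M i) (N i) (L i)) :
    IsExtension (disk M) (DCProj.disk N) (DCProj.disk L) := by
  choose f g w h using h
  exact ⟨diskMap f, diskMap g, shortExact_diskMap h⟩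

instance projective_disk [∀ i, Projective (M i)] : Projective (disk M) where
  factors f e _ :=
    ⟨diskDesc fun i => Projective.factorThru (diskι M i ≫ f.f i) (e.f i),
      disk_hom_ext fun i => by
        rw [HomologicalComplex.comp_f, ← Category.assoc, diskι_diskDesc,
          Projective.factorThru_comp]⟩

lemma epi_diskDesc {g : ∀ i, M i ⟶ H.X i} [∀ i, Epi (g i)] : Epi (diskDesc g) :=
  have (i : ℤ) : Epi ((diskDesc g).f i) := epi_of_epi_fac (diskι_diskDesc g i)
  HomologicalComplex.epi_of_epi_f _ inferInstance

lemma nonempty_iso_disk (hH : H.Acyclic)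
    (hs : ∀ i j, j + 1 = i → ∃ s : H.cycles j ⟶ H.X i, s ≫ H.toCycles i j = 𝟙 _) :
    Nonempty (disk (fun i => H.cycles (i - 1)) ≅ H) := by
  choose s hs using hs
  let g (i : ℤ) : H.cycles (i - 1) ⟶ H.X i := s i (i - 1) (by ring)
  have hg (i j : ℤ) (hij : j + 1 = i) : IsIso (g i ≫ H.toCycles i j) := by
    obtain rfl : j = i - 1 := by lia
    simp only [g, hs]
    infer_instance
  have (i : ℤ) : IsIso ((diskDesc g).f i) := by
    obtain ⟨w, h⟩ := shortExact_cycles hH (i := i) (j := i - 1) (by ring)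
    let φ : ShortComplex.mk (biprod.inl : H.cycles (i + 1 - 1) ⟶ _ ⊞ H.cycles (i - 1)) biprod.snd
        biprod.inl_snd ⟶ ShortComplex.mk _ _ w :=
      { τ₁ := g (i + 1) ≫ H.toCycles (i + 1) i
        τ₂ := (diskDesc g).f i
        τ₃ := g i ≫ H.toCycles i (i - 1)
        comm₁₂ := by simp [diskDesc]
        comm₂₃ := by apply biprod.hom_ext' <;> simp [diskDesc] }
    have : IsIso φ.τ₁ := hg (i + 1) i rfl
    have : IsIso φ.τ₃ := hg i (i - 1) (by ring)
    exact ShortComplex.isIso₂_of_shortExact_of_isIso₁₃ φ (shortExact_biprod _ _) h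
  have := HomologicalComplex.Hom.isIso_of_components (diskDesc g)
  exact ⟨asIso (diskDesc g)⟩

lemma NoExt.disk [HasExt.{w} B] [HasExt.{w'} (ChainComplex B ℤ)] [EnoughProjectives B]
    (h : ∀ i, NoExt.{w} (M i) (H.X i)) : NoExt.{w'} (disk M) H := by
  refine .of_forall_exists_shortExact (W := fun X => ∃ M : ℤ → B,
    (∀ i, NoExt.{w} (M i) (H.X i)) ∧ X = DCProj.disk M) ?_ ⟨M, h, rfl⟩
  rintro _ ⟨M, h, rfl⟩
  have hS (i : ℤ) : (ShortComplex.mk (kernel.ι (Projective.π (M i))) (Projective.π (M i))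
      (kernel.condition _)).ShortExact :=
    { exact := ShortComplex.exact_kernel _ }
  obtain ⟨w, hw⟩ := shortExact_diskMap hS
  refine ⟨_, _, _, _, w, hw, ⟨_, fun i => .left ⟨_, _, _, hS i⟩ .of_projective (h i), rfl⟩,
    .of_projective, fun k => ?_⟩
  choose l hl using fun i => exists_comp_eq_of_subsingleton_ext (hS i) (h i 0)
    (diskι (fun i => kernel (Projective.π (M i))) i ≫ k.f i)
  refine ⟨diskDesc l, disk_hom_ext fun i => ?_⟩
  rw [HomologicalComplex.comp_f, ← Category.assoc, diskι_diskMap, Category.assoc,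
    diskι_diskDesc l i, hl]

end Disk

open scoped TensorProduct

section LinearAlgebra

variable {R : Type u} [CommRing R]
variable {X Y Z : Type u} [AddCommGroup X] [AddCommGroup Y] [AddCommGroup Z] [Module R X]
  [Module R Y] [Module R Z]
variable (N F : Type u) [AddCommGroup N] [AddCommGroup F] [Module R N] [Module R F]

section HomTensor

variable (Z) in
/-- The canonical map `Hom(Z, N) ⊗ F ⟶ Hom(Z, N ⊗ F)`. -/
noncomputable def homTensor : (Z →ₗ[R] N) ⊗[R] F →ₗ[R] Z →ₗ[R] N ⊗[R] F :=
  TensorProduct.rTensorHomToHomRTensor (RingHom.id R) Z N F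

@[simp]
lemma homTensor_tmul (φ : Z →ₗ[R] N) (t : F) (z : Z) :
    homTensor Z N F (φ ⊗ₜ t) z = φ z ⊗ₜ t :=
  rfl

lemma homTensor_naturality (g : Y →ₗ[R] Z) (x : (Z →ₗ[R] N) ⊗[R] F) :
    homTensor Y N F ((LinearMap.lcomp R N g).rTensor F x) = homTensor Z N F x ∘ₗ g := by
  have : homTensor Y N F ∘ₗ (LinearMap.lcomp R N g).rTensor F =
      LinearMap.lcomp R (N ⊗[R] F) g ∘ₗ homTensor Z N F := by
    ext; simp
  exact LinearMap.congr_fun this x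

lemma homTensor_bijective_of_projective [Module.Finite R Z] [Module.Projective R Z] :
    Function.Bijective (homTensor (R := R) Z N F) := by
  have h := rTensorHomEquivHomRTensor_toLinearMap (R := R) (M := Z) (P := N) (Q := F)
  rw [homTensor, ← h]
  exact (rTensorHomEquivHomRTensor R Z N F).bijective

variable {f : X →ₗ[R] Y} {g : Y →ₗ[R] Z}

lemma homTensor_injective_right [Module.Flat R F] (hg : Function.Surjective g)
    (hY : Function.Bijective (homTensor (R := R) Y N F)) :
    Function.Injective (homTensor (R := R) Z N F) := by
  intro x y hxy
  have h : Function.Injective (LinearMap.lcomp R N g) := fun φ ψ h =>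
    (LinearMap.cancel_right hg).1 h
  apply Module.Flat.rTensor_preserves_injective_linearMap (M := F) _ h
  apply hY.1
  rw [homTensor_naturality, homTensor_naturality, hxy]

lemma homTensor_bijective_right [Module.Flat R F] (hfg : Function.Exact f g)
    (hg : Function.Surjective g) (hY : Function.Bijective (homTensor (R := R) Y N F))
    (hX : Function.Injective (homTensor (R := R) X N F)) :
    Function.Bijective (homTensor (R := R) Z N F) := by
  refine ⟨homTensor_injective_right N F hg hY, fun φ => ?_⟩
  obtain ⟨x, hx⟩ := hY.2 (φ ∘ₗ g)
  have hx' : (LinearMap.lcomp R N f).rTensor F x = 0 := by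
    apply hX
    rw [homTensor_naturality, hx, map_zero, LinearMap.comp_assoc, hfg.linearMap_comp_eq_zero,
      LinearMap.comp_zero]
  obtain ⟨y, rfl⟩ := (Module.Flat.rTensor_exact F
    (LinearMap.exact_lcomp_of_exact_of_surjective N hfg hg) x).1 hx'
  refine ⟨y, (LinearMap.cancel_right hg).1 ?_⟩
  rw [← homTensor_naturality, hx]

end HomTensor

section Bidual

variable (Z) in
/-- The canonical map `Z ⊗ F ⟶ Hom(Hom(Z, N), N ⊗ F)`. -/
noncomputable def tensorBidual : Z ⊗[R] F →ₗ[R] (Z →ₗ[R] N) →ₗ[R] N ⊗[R] F :=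
  homTensor (Z →ₗ[R] N) N F ∘ₗ (LinearMap.applyₗ (R := R) (M := Z) (M₂ := N)).rTensor F

@[simp]
lemma tensorBidual_tmul (z : Z) (t : F) (φ : Z →ₗ[R] N) :
    tensorBidual Z N F (z ⊗ₜ t) φ = φ z ⊗ₜ t :=
  rfl

lemma tensorBidual_naturality (g : Y →ₗ[R] Z) (x : Y ⊗[R] F) :
    tensorBidual Z N F (g.rTensor F x) = tensorBidual Y N F x ∘ₗ LinearMap.lcomp R N g := by
  have : tensorBidual Z N F ∘ₗ g.rTensor F =
      LinearMap.lcomp R (N ⊗[R] F) (LinearMap.lcomp R N g) ∘ₗ tensorBidual Y N F := by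
    ext; simp
  exact LinearMap.congr_fun this x

/-- The identity `hab` presents `Z` as a retract of a finite power of `Y`. -/
lemma tensorBidual_bijective_of_sum {ι : Type*} [Fintype ι] (a : ι → Z →ₗ[R] Y)
    (b : ι → Y →ₗ[R] Z) (hab : ∑ i, b i ∘ₗ a i = LinearMap.id)
    (hY : Function.Bijective (tensorBidual (R := R) Y N F)) :
    Function.Bijective (tensorBidual (R := R) Z N F) := by
  constructor
  · rw [← LinearMap.ker_eq_bot, LinearMap.ker_eq_bot']
    intro x hx
    have h (i) : (a i).rTensor F x = 0 := by
      apply hY.1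
      rw [tensorBidual_naturality, hx, map_zero, LinearMap.zero_comp]
    have h' : x = ∑ i, (b i).rTensor F ((a i).rTensor F x) := by
      have : ∑ i, (b i).rTensor F ∘ₗ (a i).rTensor F = LinearMap.id := by
        simp only [← LinearMap.rTensor_comp]
        rw [← LinearMap.rTensor_id F Z, ← hab]
        exact (map_sum (LinearMap.rTensorHom F) _ _).symm
      simpa using (LinearMap.congr_fun this x).symm
    rw [h']
    simp [h]
  · intro φ
    choose x hx using fun i => hY.2 (φ ∘ₗ LinearMap.lcomp R N (a i))
    refine ⟨∑ i, (b i).rTensor F (x i), ?_⟩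
    simp only [map_sum, tensorBidual_naturality, hx]
    ext ψ
    have : ψ = ∑ i, LinearMap.lcomp R N (a i) (LinearMap.lcomp R N (b i) ψ) := by
      ext z
      have hz : ∑ i, b i (a i z) = z := by simpa using LinearMap.congr_fun hab z
      simp [LinearMap.sum_apply, ← map_sum, hz]
    conv_rhs => rw [this, map_sum]
    simp only [LinearMap.sum_apply, LinearMap.comp_apply]

lemma tensorBidual_bijective_of_projective [Module.Finite R Z] [Module.Projective R Z]
    (hR : Function.Bijective (tensorBidual (R := R) R N F)) :
    Function.Bijective (tensorBidual (R := R) Z N F) := by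
  obtain ⟨n, f, g, -, -, hfg⟩ := Module.Finite.exists_comp_eq_id_of_projective R Z
  refine tensorBidual_bijective_of_sum N F (fun i => LinearMap.proj i ∘ₗ g)
    (fun i => f ∘ₗ LinearMap.single R (fun _ : Fin n => R) i) ?_ hR
  rw [← hfg]
  ext z
  simp only [LinearMap.sum_apply, LinearMap.comp_apply, ← map_sum]
  congr 1
  ext j
  simp [Finset.sum_apply, Pi.single_apply]

lemma tensorBidual_ring_bijective (hN : Function.Bijective (LinearMap.lsmul R N))
    (h : Function.Bijective (homTensor (R := R) N N F)) :
    Function.Bijective (tensorBidual (R := R) R N F) := by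
  let e : N ≃ₗ[R] (R →ₗ[R] N) := (LinearMap.ringLmapEquivSelf R R N).symm
  let l : R ≃ₗ[R] (N →ₗ[R] N) := LinearEquiv.ofBijective (LinearMap.lsmul R N) hN
  have key : LinearMap.lcomp R (N ⊗[R] F) e.toLinearMap ∘ₗ tensorBidual R N F =
      homTensor N N F ∘ₗ l.toLinearMap.rTensor F := by
    ext t c
    simp [e, l, LinearMap.lcomp]
  have h₁ : Function.Bijective (homTensor N N F ∘ₗ l.toLinearMap.rTensor F) :=
    h.comp (LinearEquiv.rTensor F l).bijective
  rw [← key] at h₁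
  have h₂ : Function.Bijective (LinearMap.lcomp R (N ⊗[R] F) e.toLinearMap) :=
    (LinearEquiv.congrLeft (N ⊗[R] F) R e.symm).bijective
  exact (Function.Bijective.of_comp_iff' h₂ _).1 h₁

lemma tensorBidual_self_bijective (hN : Function.Bijective (LinearMap.lsmul R N)) :
    Function.Bijective (tensorBidual (R := R) N N F) := by
  have hinj : ∀ φ ψ : (N →ₗ[R] N) →ₗ[R] N ⊗[R] F, φ LinearMap.id = ψ LinearMap.id → φ = ψ := by
    intro φ ψ h
    ext k
    obtain ⟨r, rfl⟩ := hN.2 k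
    have : LinearMap.lsmul R N r = r • LinearMap.id := by ext; simp
    rw [this, map_smul, map_smul, h]
  have hid (x : N ⊗[R] F) : tensorBidual N N F x LinearMap.id = x := by
    have : LinearMap.applyₗ LinearMap.id ∘ₗ tensorBidual N N F =
        (LinearMap.id : N ⊗[R] F →ₗ[R] N ⊗[R] F) := by
      ext; simp
    exact LinearMap.congr_fun this x
  refine ⟨fun x y h => ?_, fun φ => ⟨φ LinearMap.id, hinj _ _ (hid _)⟩⟩
  rw [← hid x, h, hid]

variable {f : X →ₗ[R] Y} {g : Y →ₗ[R] Z}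

lemma tensorBidual_bijective_left [Module.Flat R F] (hf : Function.Injective f)
    (hfg : Function.Exact f g) (hg : Function.Surjective g)
    (hN : Function.Surjective (LinearMap.lcomp R N f))
    (hY : Function.Bijective (tensorBidual (R := R) Y N F))
    (hZ : Function.Injective (tensorBidual (R := R) Z N F)) :
    Function.Bijective (tensorBidual (R := R) X N F) := by
  constructor
  · intro x y hxy
    apply Module.Flat.rTensor_preserves_injective_linearMap (M := F) f hf
    apply hY.1
    rw [tensorBidual_naturality, tensorBidual_naturality, hxy]
  · intro φ
    obtain ⟨x, hx⟩ := hY.2 (φ ∘ₗ LinearMap.lcomp R N f)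
    have hx' : g.rTensor F x = 0 := by
      apply hZ
      rw [tensorBidual_naturality, hx, map_zero]
      ext ψ
      have : (ψ ∘ₗ g) ∘ₗ f = 0 := by
        rw [LinearMap.comp_assoc, hfg.linearMap_comp_eq_zero, LinearMap.comp_zero]
      simp [LinearMap.lcomp_apply', this]
    obtain ⟨y, rfl⟩ := (rTensor_exact F hfg hg x).1 hx'
    refine ⟨y, (LinearMap.cancel_right hN).1 ?_⟩
    rw [← tensorBidual_naturality, hx]

lemma exists_comp_lcomp_eq (hg : Function.Surjective g)
    (hZ : Function.Surjective (tensorBidual (R := R) Z N F))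
    (k : (Z →ₗ[R] N) →ₗ[R] N ⊗[R] F) :
    ∃ l : (Y →ₗ[R] N) →ₗ[R] N ⊗[R] F, l ∘ₗ LinearMap.lcomp R N g = k := by
  obtain ⟨x, rfl⟩ := hZ k
  obtain ⟨y, rfl⟩ := LinearMap.rTensor_surjective F hg x
  exact ⟨tensorBidual Y N F y, (tensorBidual_naturality N F g y).symm⟩

end Bidual

lemma exists_comp_eq_of_lcomp_surjective {f : X →ₗ[R] Y} (P : Type u) [AddCommGroup P] [Module R P]
    [Module.Projective R P] (hf : Function.Surjective (LinearMap.lcomp R N f))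
    (k : X ⊗[R] P →ₗ[R] N) : ∃ l : Y ⊗[R] P →ₗ[R] N, l ∘ₗ f.rTensor P = k := by
  obtain ⟨h, hh⟩ := Module.projective_lifting_property (LinearMap.lcomp R N f)
    (TensorProduct.curry k).flip hf
  refine ⟨TensorProduct.lift h.flip, TensorProduct.ext' fun x p => ?_⟩
  simpa using LinearMap.congr_fun (LinearMap.congr_fun hh p) x

end LinearAlgebra

section Modules

variable {R : Type u} [CommRing R]

lemma shortExact_moduleCatMk {X Y Z : Type u} [AddCommGroup X] [AddCommGroup Y] [AddCommGroup Z]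
    [Module R X] [Module R Y] [Module R Z] {f : X →ₗ[R] Y} {g : Y →ₗ[R] Z}
    (hf : Function.Injective f) (hfg : Function.Exact f g) (hg : Function.Surjective g) :
    (ShortComplex.moduleCatMk f g hfg.linearMap_comp_eq_zero).ShortExact where
  exact := (ShortComplex.ShortExact.moduleCat_exact_iff_function_exact _).2 hfg
  mono_f := (ModuleCat.mono_iff_injective _).2 hf
  epi_g := (ModuleCat.epi_iff_surjective _).2 hg

section

variable {S : ShortComplex (ModuleCat.{u} R)} (hS : S.ShortExact)
include hS

lemma function_exact_of_shortExact : Function.Exact S.f.hom S.g.hom :=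
  (ShortComplex.ShortExact.moduleCat_exact_iff_function_exact _).1 hS.exact

lemma shortExact_rTensor (F : Type u) [AddCommGroup F] [Module R F] [Module.Flat R F] :
    ∃ w, (ShortComplex.moduleCatMk (S.f.hom.rTensor F) (S.g.hom.rTensor F) w).ShortExact :=
  ⟨_, shortExact_moduleCatMk
    (Module.Flat.rTensor_preserves_injective_linearMap _ hS.moduleCat_injective_f)
    (rTensor_exact F (function_exact_of_shortExact hS) hS.moduleCat_surjective_g)
    (LinearMap.rTensor_surjective F hS.moduleCat_surjective_g)⟩

variable {N : ModuleCat.{u} R} (hN : Subsingleton (Abelian.Ext.{u} S.X₃ N 1))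
include hN

lemma lcomp_surjective : Function.Surjective (LinearMap.lcomp R N S.f.hom) := fun k => by
  obtain ⟨l, hl⟩ := exists_comp_eq_of_subsingleton_ext hS hN (ModuleCat.ofHom k)
  exact ⟨l.hom, congrArg ModuleCat.Hom.hom hl⟩

lemma shortExact_lcomp :
    ∃ w, (ShortComplex.moduleCatMk (LinearMap.lcomp R N S.g.hom)
      (LinearMap.lcomp R N S.f.hom) w).ShortExact :=
  ⟨_, shortExact_moduleCatMk
    (fun _ _ hφ => (LinearMap.cancel_right hS.moduleCat_surjective_g).1 hφ)
    (LinearMap.exact_lcomp_of_exact_of_surjective N (function_exact_of_shortExact hS)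
      hS.moduleCat_surjective_g) (lcomp_surjective hS hN)⟩

end

lemma projective_of_moduleProjective (M : ModuleCat.{u} R) [Module.Projective R M] :
    Projective M :=
  (IsProjective.iff_projective M).1 inferInstance

lemma NoExt.of_moduleProjective (M N : ModuleCat.{u} R) [Module.Projective R M] :
    NoExt.{u} M N :=
  have := projective_of_moduleProjective M
  .of_projective

lemma exists_isSyzygy_projMod (M : ModuleCat.{u} R) : ∃ K, IsSyzygy (projMod R) K M :=
  ⟨_, _, (IsProjective.iff_projective _).2 (Projective.projective_over M),
    .of_epi (Projective.π M)⟩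

lemma NoExt.tensor_projective {M N : ModuleCat.{u} R} (h : NoExt.{u} M N) (P : Type u)
    [AddCommGroup P] [Module R P] [Module.Projective R P] :
    NoExt.{u} (ModuleCat.of R (M ⊗[R] P)) N := by
  refine .of_forall_exists_shortExact (W := fun X => ∃ M : ModuleCat.{u} R,
    NoExt.{u} M N ∧ X = ModuleCat.of R (M ⊗[R] P)) ?_ ⟨M, h, rfl⟩
  rintro _ ⟨M, h, rfl⟩
  obtain ⟨K, L, hL, f, g, w, hS⟩ := exists_isSyzygy_projMod M
  have : Module.Projective R L := hL
  have hK : NoExt.{u} K N := .left ⟨f, g, w, hS⟩ (.of_moduleProjective _ _) h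
  obtain ⟨w', hS'⟩ := shortExact_rTensor hS P
  refine ⟨_, _, _, _, _, hS', ⟨K, hK, rfl⟩, .of_moduleProjective _ _, fun k => ?_⟩
  obtain ⟨l, hl⟩ := exists_comp_eq_of_lcomp_surjective N P (lcomp_surjective hS (h 0)) k.hom
  exact ⟨ModuleCat.ofHom l, ModuleCat.hom_ext hl⟩

/-- The class of finitely generated projective modules. -/
def fgProj (R : Type u) [CommRing R] : ObjectProperty (ModuleCat.{u} R) :=
  fun M => Module.Finite R M ∧ Module.Projective R M

section

variable {Z N : ModuleCat.{u} R} (hZ : HasExactResolution (fun _ => fgProj R) Z)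
  (F : Type u) [AddCommGroup F] [Module R F] [Module.Flat R F]
include hZ

lemma homTensor_bijective_of_hasExactResolution (N : Type u) [AddCommGroup N] [Module R N] :
    Function.Bijective (homTensor (R := R) Z N F) := by
  obtain ⟨X, ⟨Y, ⟨_, _⟩, f, g, w, hS⟩, hX⟩ := hasExactResolution_iff_exists_isSyzygy.1 hZ
  obtain ⟨_, ⟨Y', ⟨_, _⟩, f', g', w', hS'⟩, -⟩ := hasExactResolution_iff_exists_isSyzygy.1 hX
  exact homTensor_bijective_right N F (function_exact_of_shortExact hS) hS.moduleCat_surjective_g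
    (homTensor_bijective_of_projective N F)
    (homTensor_injective_right N F hS'.moduleCat_surjective_g
      (homTensor_bijective_of_projective N F))

lemma noExt_tensor_of_hasExactResolution (h : NoExt.{u} Z N) :
    NoExt.{u} Z (ModuleCat.of R (N ⊗[R] F)) := by
  refine .of_forall_exists_shortExact
    (W := fun Z => HasExactResolution (fun _ => fgProj R) Z ∧ NoExt.{u} Z N) ?_ ⟨hZ, h⟩
  rintro Z ⟨hZ, h⟩
  obtain ⟨X, ⟨Y, ⟨_, _⟩, f, g, w, hS⟩, hX⟩ := hasExactResolution_iff_exists_isSyzygy.1 hZ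
  refine ⟨X, Y, f, g, w, hS, ⟨hX, .left ⟨f, g, w, hS⟩ (.of_moduleProjective _ _) h⟩,
    .of_moduleProjective _ _, fun k => ?_⟩
  obtain ⟨x, hx⟩ := (homTensor_bijective_of_hasExactResolution hX F N).2 k.hom
  obtain ⟨y, rfl⟩ := LinearMap.rTensor_surjective F (lcomp_surjective hS (h 0)) x
  exact ⟨ModuleCat.ofHom (homTensor Y N F y),
    ModuleCat.hom_ext ((homTensor_naturality N F f.hom y).symm.trans hx)⟩

end

section Semidualizing

variable {C : ModuleCat.{u} R}

namespace IsSemidualizing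

variable (hC : IsSemidualizing C)
include hC

lemma hasExactResolution : HasExactResolution (fun _ => fgProj R) C := by
  obtain ⟨P, hP⟩ := hC.resolution
  exact ⟨{ G := P.complex
           ε := P.π.f 0
           w := P.complex_d_comp_π_f_zero
           epi_ε := inferInstanceAs (Epi (P.π.f 0))
           exact_zero := P.exact₀
           exact_succ := P.complex_exactAt_succ },
    fun i => ⟨hP i, (IsProjective.iff_projective _).2 (P.projective i)⟩⟩

lemma noExt_self : NoExt.{u} C C :=
  fun n => hC.ext_eq_zero (n + 1) (by lia)

lemma noExt_tensor (P F : Type u) [AddCommGroup P] [Module R P] [Module.Projective R P]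
    [AddCommGroup F] [Module R F] [Module.Flat R F] :
    NoExt.{u} (ModuleCat.of R (C ⊗[R] P)) (ModuleCat.of R (C ⊗[R] F)) :=
  (noExt_tensor_of_hasExactResolution hC.hasExactResolution F hC.noExt_self).tensor_projective P

lemma cProjMod_le_extPerp : cProjMod C ≤ extPerp.{u} (cFlatMod C) := by
  rintro M ⟨P, _, ⟨e⟩⟩ N ⟨F, _, ⟨e'⟩⟩
  exact ((hC.noExt_tensor P F).of_iso e.symm.toModuleIso).of_iso_right e'.symm.toModuleIso

lemma noExt_hom (Y F : Type u) [AddCommGroup Y] [Module R Y] [Module.Finite R Y]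
    [Module.Projective R Y] [AddCommGroup F] [Module R F] [Module.Flat R F] :
    NoExt.{u} (ModuleCat.of R (Y →ₗ[R] C)) (ModuleCat.of R (C ⊗[R] F)) :=
  (hC.noExt_tensor (Module.Dual R Y) F).of_iso
    (TensorProduct.comm R _ _ ≪≫ₗ dualTensorHomEquiv R Y C).toModuleIso

end IsSemidualizing

lemma cProjMod_hom_tensor (C : ModuleCat.{u} R) (Y P : Type u) [AddCommGroup Y] [Module R Y]
    [Module.Finite R Y] [Module.Projective R Y] [AddCommGroup P] [Module R P]
    [Module.Projective R P] : cProjMod C (ModuleCat.of R ((Y →ₗ[R] C) ⊗[R] P)) :=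
  ⟨ModuleCat.of R (Module.Dual R Y ⊗[R] P), inferInstance,
    ⟨TensorProduct.congr ((dualTensorHomEquiv R Y C).symm ≪≫ₗ TensorProduct.comm R _ _)
      (LinearEquiv.refl R P) ≪≫ₗ TensorProduct.assoc R C (Module.Dual R Y) P⟩⟩

/-- Modules with a resolution by finitely generated projective modules on which the duality
`Hom(-, C)` is exact and reflexive, also after tensoring with a flat module; the syzygies of `C`
are of this kind. -/
structure IsDualizable (C Z : ModuleCat.{u} R) : Prop where
  resolution : HasExactResolution (fun _ => fgProj R) Z
  noExt : NoExt.{u} Z C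
  bidual : ∀ (F : Type u) [AddCommGroup F] [Module R F] [Module.Flat R F],
    Function.Bijective (tensorBidual (R := R) Z C F)
  noExt_dual : ∀ (F : Type u) [AddCommGroup F] [Module R F] [Module.Flat R F],
    NoExt.{u} (ModuleCat.of R (Z →ₗ[R] C)) (ModuleCat.of R (C ⊗[R] F))

/-- The class of modules `Hom(Z, C) ⊗ P` with `Z` dualizable and `P` projective. It contains the
projective modules `P ≅ Hom(C, C) ⊗ P` and admits coresolutions by `C`-projective modules. -/
def dualTensorMod (C : ModuleCat.{u} R) : ObjectProperty (ModuleCat.{u} R) :=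
  fun M => ∃ Z P : ModuleCat.{u} R, IsDualizable C Z ∧ Module.Projective R P ∧
    Nonempty (M ≃ₗ[R] (Z →ₗ[R] C) ⊗[R] P)

lemma dualTensorMod_le_extPerp : dualTensorMod C ≤ extPerp.{u} (cFlatMod C) := by
  rintro M ⟨Z, P, hZ, _, ⟨e⟩⟩ N ⟨F, _, ⟨e'⟩⟩
  exact (((hZ.noExt_dual F).tensor_projective P).of_iso e.symm.toModuleIso).of_iso_right
    e'.symm.toModuleIso

namespace IsSemidualizing

variable (hC : IsSemidualizing C)
include hC

lemma isDualizable : IsDualizable C C where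
  resolution := hC.hasExactResolution
  noExt := hC.noExt_self
  bidual _ _ _ _ := tensorBidual_self_bijective C _ hC.homothety
  noExt_dual _ _ _ _ := (NoExt.of_moduleProjective (ModuleCat.of R R) _).of_iso
    (LinearEquiv.ofBijective _ hC.homothety).toModuleIso

lemma dualTensorMod_of_projMod : projMod R ≤ dualTensorMod C := fun M hM =>
  ⟨C, M, hC.isDualizable, hM, ⟨(TensorProduct.lid R M).symm ≪≫ₗ
    TensorProduct.congr (LinearEquiv.ofBijective _ hC.homothety) (LinearEquiv.refl R M)⟩⟩

lemma exists_shortExact_isDualizable {Z : ModuleCat.{u} R} (hZ : IsDualizable C Z) :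
    ∃ (X Y : ModuleCat.{u} R) (f : X ⟶ Y) (g : Y ⟶ Z) (w : f ≫ g = 0),
      (ShortComplex.mk f g w).ShortExact ∧ fgProj R Y ∧ IsDualizable C X := by
  obtain ⟨X, ⟨Y, ⟨hY₁, hY₂⟩, f, g, w, hS⟩, hX⟩ :=
    hasExactResolution_iff_exists_isSyzygy.1 hZ.resolution
  have hY (F : Type u) [AddCommGroup F] [Module R F] [Module.Flat R F] :
      Function.Bijective (tensorBidual (R := R) Y C F) :=
    tensorBidual_bijective_of_projective C F (tensorBidual_ring_bijective C F hC.homothety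
      (homTensor_bijective_of_hasExactResolution hC.hasExactResolution F C))
  refine ⟨X, Y, f, g, w, hS, ⟨hY₁, hY₂⟩, hX,
    .left ⟨f, g, w, hS⟩ (.of_moduleProjective _ _) hZ.noExt, fun F _ _ _ => ?_, fun F _ _ _ => ?_⟩
  · exact tensorBidual_bijective_left C F hS.moduleCat_injective_f (function_exact_of_shortExact hS)
      hS.moduleCat_surjective_g (lcomp_surjective hS (hZ.noExt 0)) (hY F) (hZ.bidual F).1
  · obtain ⟨w', hS'⟩ := shortExact_lcomp hS (hZ.noExt 0)
    refine .right hS' (hZ.noExt_dual F) (hC.noExt_hom Y F) fun k => ?_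
    obtain ⟨l, hl⟩ :=
      exists_comp_lcomp_eq C F hS.moduleCat_surjective_g (hZ.bidual F).2 k.hom
    exact ⟨ModuleCat.ofHom l, ModuleCat.hom_ext hl⟩

lemma exists_isSyzygy_of_dualTensorMod {M : ModuleCat.{u} R} (hM : dualTensorMod C M) :
    ∃ L, dualTensorMod C L ∧ IsSyzygy (cProjMod C) M L := by
  obtain ⟨Z, P, hZ, _, ⟨e⟩⟩ := hM
  obtain ⟨X, Y, f, g, w, hS, ⟨_, _⟩, hX⟩ := hC.exists_shortExact_isDualizable hZ
  obtain ⟨w₁, h₁⟩ := shortExact_lcomp hS (hZ.noExt 0)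
  obtain ⟨w₂, h₂⟩ := shortExact_rTensor h₁ P
  have h : IsExtension (ModuleCat.of R ((Z →ₗ[R] C) ⊗[R] P)) _ _ := ⟨_, _, _, h₂⟩
  exact ⟨_, ⟨X, P, hX, inferInstance, ⟨LinearEquiv.refl _ _⟩⟩, _, cProjMod_hom_tensor C Y P,
    h.of_iso e.symm.toModuleIso (.refl _) (.refl _)⟩

end IsSemidualizing

end Semidualizing

end Modules

section Tilde

variable {R : Type u} [CommRing R] {P Q : ObjectProperty (ModuleCat.{u} R)} {X Y : Ch R}

instance [P.IsClosedUnderIsomorphisms] : (tilde P).IsClosedUnderIsomorphisms where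
  of_iso e hX := ⟨fun i => HomologicalComplex.ExactAt.of_iso (hX.1 i) e,
    fun i => P.prop_of_iso ((HomologicalComplex.cyclesFunctor _ _ i).mapIso e) (hX.2 i)⟩

lemma tilde_mono (h : P ≤ Q) : tilde P ≤ tilde Q :=
  fun _ hX => ⟨hX.1, fun i => h _ (hX.2 i)⟩

lemma tilde_of_isZero (hP : ∀ M, IsZero M → P M) (hX : IsZero X) : tilde P X := by
  have h (i : ℤ) : IsZero (X.X i) := (HomologicalComplex.eval _ _ i).map_isZero hX
  exact ⟨fun i => ShortComplex.exact_of_isZero_X₂ _ (h i),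
    fun i => hP _ ((h i).of_mono (X.iCycles i))⟩

lemma tilde_biprod [P.IsClosedUnderIsomorphisms] (hP : ∀ M N, P M → P N → P (M ⊞ N))
    (hX : tilde P X) (hY : tilde P Y) : tilde P (X ⊞ Y) := by
  refine ⟨(shortExact_biprod X Y).acyclic_X₂ hX.1 hY.1, fun i => ?_⟩
  let F : Ch R ⥤ ModuleCat.{u} R := HomologicalComplex.cyclesFunctor _ _ i
  let G := HomologicalComplex.shortComplexFunctor (ModuleCat.{u} R) (ComplexShape.down ℤ) i
  have : F.Additive := ⟨fun {_ _ f g} => ShortComplex.cyclesMap_add (G.map f) (G.map g)⟩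
  have := preservesBinaryBiproduct_of_preservesBiproduct F X Y
  exact P.prop_of_iso (F.mapBiprod X Y).symm (hP _ _ (hX.2 i) (hY.2 i))

lemma tilde_disk [P.IsClosedUnderIsomorphisms] {M : ℤ → ModuleCat.{u} R} (hM : ∀ i, P (M i)) :
    tilde P (disk M) :=
  ⟨acyclic_disk M, fun i => P.prop_of_iso (nonempty_cycles_disk_iso M i).some.symm (hM (i + 1))⟩

lemma exists_iso_disk (hX : tilde P X)
    (hP : ∀ M N, P M → P N → Subsingleton (Abelian.Ext.{u} M N 1)) :
    ∃ M : ℤ → ModuleCat.{u} R, (∀ i, P (M i)) ∧ Nonempty (disk M ≅ X) := by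
  refine ⟨fun i => X.cycles (i - 1), fun i => hX.2 _, nonempty_iso_disk hX.1 fun i j hij => ?_⟩
  obtain ⟨w, h⟩ := shortExact_cycles hX.1 hij
  obtain ⟨r, hr⟩ := exists_comp_eq_of_subsingleton_ext h (hP _ _ (hX.2 j) (hX.2 i)) (𝟙 _)
  exact ⟨_, (ShortComplex.Splitting.ofExactOfRetraction _ h.exact r hr h.epi_g).s_g⟩

lemma exists_isSyzygy_tilde [P.IsClosedUnderIsomorphisms] (hP : ∀ M, ∃ K, IsSyzygy P K M)
    (X : Ch R) : ∃ K, IsSyzygy (tilde P) K X := by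
  choose K M hM f g w h using hP
  have (i : ℤ) : Epi (g (X.X i)) := (h (X.X i)).epi_g
  have : Epi (diskDesc fun i => g (X.X i)) := epi_diskDesc
  exact ⟨_, _, tilde_disk fun i => hM (X.X i), .of_epi (diskDesc fun i => g (X.X i))⟩

lemma extPerp_tilde_disk {M : ℤ → ModuleCat.{u} R} (hM : ∀ i, extPerp.{u} P (M i)) :
    extPerp.{u} (tilde P) (disk M) := fun H hH => .disk fun i => by
  obtain ⟨w, h⟩ := shortExact_cycles hH.1 (show i - 1 + 1 = i by ring)
  exact .covariant_mid ⟨_, _, w, h⟩ (hM i _ (hH.2 i)) (hM i _ (hH.2 (i - 1)))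

end Tilde

section Classes

variable {R : Type u} [CommRing R]

instance : (projMod R).IsClosedUnderIsomorphisms where
  of_iso e := fun (_ : Module.Projective R _) => Module.Projective.of_equiv e.toLinearEquiv

instance (C : ModuleCat.{u} R) : (cProjMod C).IsClosedUnderIsomorphisms where
  of_iso e := fun ⟨P, hP, ⟨e'⟩⟩ => ⟨P, hP, ⟨e.toLinearEquiv.symm ≪≫ₗ e'⟩⟩

instance (C : ModuleCat.{u} R) : (cFlatMod C).IsClosedUnderIsomorphisms where
  of_iso e := fun ⟨P, hP, ⟨e'⟩⟩ => ⟨P, hP, ⟨e.toLinearEquiv.symm ≪≫ₗ e'⟩⟩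

lemma cProjMod_le_cFlatMod (C : ModuleCat.{u} R) : cProjMod C ≤ cFlatMod C :=
  fun _ ⟨P, _, e⟩ => ⟨P, inferInstance, e⟩

lemma cProjMod_of_isZero (C : ModuleCat.{u} R) {M : ModuleCat.{u} R} (hM : IsZero M) :
    cProjMod C M := by
  have := ModuleCat.subsingleton_of_isZero hM
  exact ⟨ModuleCat.of R PUnit, inferInstance, ⟨0, 0, fun _ => Subsingleton.elim _ _,
    fun _ => Subsingleton.elim _ _⟩⟩

lemma cProjMod_biprod {C M N : ModuleCat.{u} R} (hM : cProjMod C M) (hN : cProjMod C N) :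
    cProjMod C (M ⊞ N) := by
  obtain ⟨P, _, ⟨e⟩⟩ := hM
  obtain ⟨Q, _, ⟨e'⟩⟩ := hN
  exact ⟨ModuleCat.of R (P × Q), inferInstance, ⟨(ModuleCat.biprodIsoProd M N).toLinearEquiv ≪≫ₗ
    LinearEquiv.prodCongr e e' ≪≫ₗ (TensorProduct.prodRight R R C P Q).symm⟩⟩

lemma exists_iso_disk_of_projCx {X : Ch R} (hX : projCx R X) :
    ∃ M : ℤ → ModuleCat.{u} R, (∀ i, projMod R (M i)) ∧ Nonempty (disk M ≅ X) :=
  exists_iso_disk hX fun M N (_ : Module.Projective R M) _ => NoExt.of_moduleProjective M N 0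

lemma projective_of_projCx {X : Ch R} (hX : projCx R X) : Projective X := by
  obtain ⟨M, hM, ⟨e⟩⟩ := exists_iso_disk_of_projCx hX
  have (i : ℤ) : Projective (M i) := (IsProjective.iff_projective _).1 (hM i)
  exact Projective.of_iso e projective_disk

namespace IsSemidualizing

variable {C : ModuleCat.{u} R} (hC : IsSemidualizing C)
include hC

lemma cProjCx_le_extPerp : cProjCx C ≤ extPerp.{u} (cFlatCx C) := by
  intro X hX
  obtain ⟨M, hM, ⟨e⟩⟩ := exists_iso_disk hX fun M N hM hN =>
    hC.cProjMod_le_extPerp M hM N (cProjMod_le_cFlatMod C N hN) 0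
  have hD : extPerp.{u} (cFlatCx C) (disk M) :=
    extPerp_tilde_disk fun i => hC.cProjMod_le_extPerp _ (hM i)
  exact fun H hH => (hD H hH).of_iso e

lemma isAdmissible : IsAdmissible.{u} (projCx R) (cProjCx C) (cFlatCx C) where
  projective _ := projective_of_projCx
  exists_isSyzygy := exists_isSyzygy_tilde exists_isSyzygy_projMod
  le := tilde_mono (cProjMod_le_cFlatMod C)
  le_extPerp := hC.cProjCx_le_extPerp
  of_isZero _ := tilde_of_isZero fun _ => cProjMod_of_isZero C
  biprod _ _ := tilde_biprod fun _ _ => cProjMod_biprod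
  of_iso _ _ := (tilde (cProjMod C)).prop_of_iso

lemma gorensteinProj_disk {M : ℤ → ModuleCat.{u} R} (hM : ∀ i, dualTensorMod C (M i)) :
    gorensteinProj (projCx R) (cProjCx C) (cFlatCx C) (disk M) := by
  refine hC.isAdmissible.gorensteinProj_of_coresolving (W := fun X => ∃ M : ℤ → ModuleCat.{u} R,
    (∀ i, dualTensorMod C (M i)) ∧ X = disk M) ?_ ?_ ⟨M, hM, rfl⟩
  · rintro _ ⟨M, hM, rfl⟩
    exact extPerp_tilde_disk fun i => dualTensorMod_le_extPerp _ (hM i)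
  · rintro _ ⟨M, hM, rfl⟩
    choose L hL Q hQ h using fun i => hC.exists_isSyzygy_of_dualTensorMod (hM i)
    exact ⟨disk L, ⟨L, hL, rfl⟩, disk Q, tilde_disk hQ, .disk h⟩

lemma projCx_le_gorensteinProj :
    projCx R ≤ gorensteinProj (projCx R) (cProjCx C) (cFlatCx C) := by
  intro X hX
  obtain ⟨M, hM, ⟨e⟩⟩ := exists_iso_disk_of_projCx hX
  exact (gorensteinProj _ _ _).prop_of_iso e
    (hC.gorensteinProj_disk fun i => hC.dualTensorMod_of_projMod _ (hM i))

end IsSemidualizing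

end Classes

end DCProj

theorem theorem3p3 {R : Type u} [CommRing R] (C : ModuleCat.{u} R) (hC : DCProj.IsSemidualizing C)
    (X : DCProj.Ch R) (n : ℕ) :
    List.TFAE [
      DCProj.dcPd C X ≤ n,
      DCProj.dcPd C X < ⊤ ∧ ∀ m : ℕ, n < m → ∀ H : DCProj.Ch R, DCProj.fcPd C H < ⊤ →
        Subsingleton (Abelian.Ext.{u} X H m),
      DCProj.dcPd C X < ⊤ ∧ ∀ m : ℕ, n < m → ∀ H : DCProj.Ch R, DCProj.cFlatCx C H →
        Subsingleton (Abelian.Ext.{u} X H m),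
      ∀ E : DCProj.ExactResolution X, (∀ i : ℕ, DCProj.dcProjCx C (E.G.X i)) →
        DCProj.dcProjCx C (E.kernelObj n),
      ∀ t : ℕ, t ≤ n → ∃ E : DCProj.ExactResolution X,
        (∀ i : ℕ, i < t → DCProj.projCx R (E.G.X i)) ∧
        DCProj.dcProjCx C (E.G.X t) ∧
        (∀ i : ℕ, t < i → i ≤ n → DCProj.cProjCx C (E.G.X i)) ∧
        ∀ i : ℕ, n < i → Limits.IsZero (E.G.X i)] :=
  have : (DCProj.cFlatCx C).IsClosedUnderIsomorphisms :=
    inferInstanceAs (DCProj.tilde (DCProj.cFlatMod C)).IsClosedUnderIsomorphisms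
  hC.isAdmissible.tfae hC.projCx_le_gorensteinProj X n
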